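/- Let $k$ be an algebraically closed field of characteristic zero and $R=k[x_0,x_1,x_2]$. Let $d\ge 3$ and $0<a<d/2$ be integers with $\gcd(a,d)=1$, let $\varepsilon\in k$ be a primitive $2d$-th root of unity and $e=\varepsilon^2$. Let $D_{2d}=\langle\tau,\eta\mid\tau^d=\eta^2=(\eta\tau)^2=1\rangle$ be the dihedral group of order $2d$, acting on $R$ by linear substitutions through the representation $\rho_a:D_{2d}\to \mathrm{GL}(3,k)$ with $\rho_a(\tau)=\mathrm{diag}(1,e^a,e^{d-a})$ and $\rho_a(\eta)$ the permutation matrix exchanging $x_1$ and $x_2$. Let $\overline{D_{2d}}\subset \mathrm{GL}(3,k)$ be the group generated by $\rho_a(D_{2d})$ and $\varepsilon\,\mathrm{Id}$, and let $\mu_{2d}$ be the dimension of the space of forms of degree $2d$ in $R$ invariant under $\overline{D_{2d}}$. Let $\mathcal B_{2d}$ be the set consisting of the monomials $x_0^{2d-2c}x_1^cx_2^c$, $0\le c\le d$, and of the binomials $x_0^{a_0}x_1^{a_1}x_2^{a_2}+x_0^{a_0}x_1^{a_2}x_2^{a_1}$ with $a_0+a_1+a_2=2d$, $a_1\ne a_2$,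 such that $x_0^{a_0}x_1^{a_1}x_2^{a_2}$ is invariant under $\mathrm{diag}(1,e,e^{d-1})$. Let $I_{2d}\subset R$ be the ideal generated by $\mathcal B_{2d}$. Definitions. An ideal $I$ of $k[x_0,\dots,x_n]$ fails the weak Lefschetz property (WLP) from degree $j$ to degree $j+1$ if for every linear form $L$ the map $\times L:(R/I)_j\to(R/I)_{j+1}$ (where $R=k[x_0,\dots,x_n]$) is neither injective nor surjective. A Togliatti system is an artinian ideal $I\subset k[x_0,\dots,x_n]$ generated by $r\le\binom{n+N-1}{n-1}$ forms $F_1,\dots,F_r$ of degree $N$ that fails the WLP from degree $N-1$ to $N$. A Galois covering with group $G$ is a finite surjective morphism $f:Y\to X$ such that the group $\mathrm{Aut}(f)$ of automorphisms $g$ of $Y$ with $f\circ g=f$ acts transitively on each fibre of $f$ and is isomorphic to $G$. A GT-system with group $G$ is a Togliatti system $I=(F_1,\dots,F_r)$ whose associated morphism $\varphi_I=[F_1:\dots:F_r]:\mathbb P^n\to\mathbb P^{r-1}$ is a Galois covering of its image with group $G$. Then: 1. $\mathcal B_{2d}$ has exactly $\mu_{2d}$ elements, $\mu_{2d}\le 2d+1$,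 and $I_{2d}$ is also the ideal generated by all forms of degree $2d$ invariant under $\overline{D_{2d}}$. 2. $I_{2d}$ is artinian and is not generated by monomials. 3. $I_{2d}$ fails the WLP from degree $2d-1$ to degree $2d$; more precisely, every linear form $L$ satisfies $L\prod_{g\in D_{2d},\,g\ne1}g(L)\in I_{2d}$, and $\prod_{g\in D_{2d},\,g\neq1}g(L)\notin I_{2d}$ if $L\ne0$. 4. $I_{2d}$ is a GT-system with group $D_{2d}$: the generators $\mathcal B_{2d}$ (in any order) form a Togliatti system, and the morphism $\varphi_{I_{2d}}:\mathbb P^2\to\mathbb P^{\mu_{2d}-1}$ is a Galois covering of its image with group $D_{2d}$. -/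

import Mathlib

open MvPolynomial CategoryTheory AlgebraicGeometry

universe u

namespace GTSystem

noncomputable section

section WeakLefschetz

variable {k : Type u} [Field k] {n : ℕ}

/-- The graded piece `(R/I)_j`, as a subspace of `R/I`, where `R = k[x_0, …, x_{n-1}]`:
the image of the forms of degree `j`. -/
def quotPiece (I : Ideal (MvPolynomial (Fin n) k)) (j : ℕ) :
    Submodule k (MvPolynomial (Fin n) k ⧸ I) :=
  (homogeneousSubmodule (Fin n) k j).map (Ideal.Quotient.mkₐ k I).toLinearMap

/-- The multiplication map `×L : (R/I)_j → (R/I)_{j+1}` has maximal rank,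
i.e. it is injective or surjective. -/
def MulHasMaximalRank (I : Ideal (MvPolynomial (Fin n) k)) (L : MvPolynomial (Fin n) k)
    (j : ℕ) : Prop :=
  Set.InjOn (fun x => Ideal.Quotient.mk I L * x) (quotPiece I j) ∨
    Set.SurjOn (fun x => Ideal.Quotient.mk I L * x) (quotPiece I j) (quotPiece I (j + 1))

/-- `I` fails the weak Lefschetz property in degree `j` (from degree `j` to degree `j + 1`):
for no linear form `L` does `×L : (R/I)_j → (R/I)_{j+1}` have maximal rank. -/
def FailsWLPInDegree (I : Ideal (MvPolynomial (Fin n) k)) (j : ℕ) : Prop :=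
  ∀ L ∈ homogeneousSubmodule (Fin n) k 1, ¬ MulHasMaximalRank I L j

/-- A Togliatti system in `k[x_0, …, x_n]`: an artinian ideal generated by
`r ≤ binom(n + N - 1, n - 1)` forms `F_1, …, F_r` of degree `N` that fails the weak Lefschetz
property in degree `N - 1`. -/
structure IsTogliattiSystem {r : ℕ} (N : ℕ) (F : Fin r → MvPolynomial (Fin (n + 1)) k) :
    Prop where
  isHomogeneous : ∀ i, (F i).IsHomogeneous N
  card_le : r ≤ (n + N - 1).choose (n - 1)
  isArtinian : IsArtinianRing (MvPolynomial (Fin (n + 1)) k ⧸ Ideal.span (Set.range F))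
  failsWLP : FailsWLPInDegree (Ideal.span (Set.range F)) (N - 1)

/-- An ideal of a polynomial ring generated by monomials. -/
def IsMonomialIdeal (I : Ideal (MvPolynomial (Fin n) k)) : Prop :=
  ∃ S : Set (Fin n →₀ ℕ), I = Ideal.span ((fun s => monomial s (1 : k)) '' S)

end WeakLefschetz

section Galois

attribute [local instance] MvPolynomial.gradedAlgebra

/-- The group `Aut(f)` of deck transformations of `f : Y ⟶ X`:
the automorphisms `g` of `Y` with `f ∘ g = f`. -/
abbrev DeckGroup {Y X : Scheme.{u}} (f : Y ⟶ X) : Type u := Aut (Over.mk f)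

/-- `f : Y ⟶ X` is a Galois covering with group `G`: `f` is finite and surjective, the group of
deck transformations acts transitively on each fibre, and it is isomorphic to `G`. -/
structure IsGaloisCovering {Y X : Scheme.{u}} (f : Y ⟶ X) (G : Type*) [Group G] : Prop where
  isFinite : IsFinite f
  surjective : Function.Surjective f
  transitive : ∀ y y' : Y, f y = f y' → ∃ g : DeckGroup f, g.hom.left y = y'
  group : Nonempty (DeckGroup f ≃* G)

variable {k : Type u} [Field k]

variable (k) in
/-- The projective space over `k` with `m` homogeneous coordinates, i.e. `ℙ^{m-1}`. -/
abbrev projSpace (m : ℕ) : Scheme.{u} := Proj (homogeneousSubmodule (Fin m) k)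

/-- `φ : ℙ^{m-1} ⟶ ℙ^{r-1}` is the morphism `[F_1 : ⋯ : F_r]` given by the forms `F_1, …, F_r` of
the same degree `N > 0` without common zeros. This says that the open sets `D₊(F_i)` cover
`ℙ^{m-1}` and that on `D₊(F_i) = Spec k[x]_{(F_i)}` the morphism `φ` is the morphism to
`D₊(w_i) = Spec k[w]_{(w_i)}` given by the ring homomorphism `θ` with `θ(w_j/w_i) = F_j/F_i`,
i.e. the restriction to degree zero of the homomorphism `k[w]_{w_i} → k[x]_{F_i}` induced by
`w_j ↦ F_j`. (Note that `aeval F (X i) = F i`.) -/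
structure IsMorphismOfForms {m r N : ℕ} (hN : 0 < N) (F : Fin r → MvPolynomial (Fin m) k)
    (hF : ∀ i, (F i).IsHomogeneous N) (φ : projSpace k m ⟶ projSpace k r) : Prop where
  cover : ⨆ i, Proj.basicOpen (homogeneousSubmodule (Fin m) k) (F i) = ⊤
  restrict : ∀ i, ∃ θ : HomogeneousLocalization.Away (homogeneousSubmodule (Fin r) k) (X i) →+*
      HomogeneousLocalization.Away (homogeneousSubmodule (Fin m) k) (aeval F (X i)),
    (∀ z, (θ z).val = Localization.awayMap (aeval F).toRingHom (X i) z.val) ∧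
    Proj.awayι (homogeneousSubmodule (Fin m) k) (aeval F (X i)) (m := N)
        (by rw [aeval_X]; exact hF i) hN ≫ φ =
      Spec.map (CommRingCat.ofHom θ) ≫
        Proj.awayι (homogeneousSubmodule (Fin r) k) (X i) (m := 1)
          (isHomogeneous_X k i) one_pos

/-- A GT-system with group `G`: a Togliatti system `I = (F_1, …, F_r)` such that the associated
morphism `φ_I : ℙ^n → ℙ^{r-1}` is a Galois covering, of its image, with group `G`. -/
structure IsGTSystem {n r N : ℕ} (hN : 0 < N) (F : Fin r → MvPolynomial (Fin (n + 1)) k)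
    (G : Type*) [Group G] : Prop extends IsTogliattiSystem N F where
  galois : ∃ φ : projSpace k (n + 1) ⟶ projSpace k r,
    IsMorphismOfForms hN F isHomogeneous φ ∧ IsGaloisCovering φ.toImage G

end Galois

section Dihedral

/-- Elements `x, y` of a group with `x ^ d = y ^ 2 = (y * x) ^ 2 = 1` define a homomorphism from
the dihedral group of order `2 * d`, with `r i ↦ x ^ i` and `sr i ↦ y * x ^ i`. -/
def dihedralLift {G : Type*} [Group G] (d : ℕ) [NeZero d] (x y : G) (hx : x ^ d = 1)
    (hy : y ^ 2 = 1) (hyx : (y * x) ^ 2 = 1) : DihedralGroup d →* G where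
  toFun
    | .r i => x ^ i.val
    | .sr i => y * x ^ i.val
  map_one' := by
    change x ^ (0 : ZMod d).val = 1
    simp
  map_mul' := by
    have hy' : y * y = 1 := by rw [← sq, hy]
    have hadd : ∀ i j : ZMod d, x ^ (i + j).val = x ^ i.val * x ^ j.val := fun i j => by
      rw [ZMod.val_add, ← pow_eq_pow_mod _ hx, pow_add]
    have hsub : ∀ i j : ZMod d, x ^ (j - i).val = (x ^ i.val)⁻¹ * x ^ j.val := fun i j => by
      rw [eq_inv_mul_iff_mul_eq, ← hadd]
      congr 2
      ring
    have hconj : y * x * y⁻¹ = x⁻¹ := by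
      rw [eq_inv_iff_mul_eq_one, inv_eq_of_mul_eq_one_right hy', mul_assoc (y * x), ← sq, hyx]
    have hpow : ∀ m : ℕ, x ^ m * y = y * (x ^ m)⁻¹ := fun m => by
      have h := conj_pow (i := m) (a := y) (b := x)
      rw [hconj, inv_pow] at h
      rw [h, inv_eq_of_mul_eq_one_right hy', mul_assoc, ← mul_assoc, ← mul_assoc, hy', one_mul]
    rintro (i | i) (j | j)
    · exact hadd i j
    · change y * x ^ (j - i).val = x ^ i.val * (y * x ^ j.val)
      rw [hsub, ← mul_assoc, ← mul_assoc, hpow]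
    · change y * x ^ (i + j).val = y * x ^ i.val * x ^ j.val
      rw [hadd, mul_assoc]
    · change x ^ (j - i).val = y * x ^ i.val * (y * x ^ j.val)
      rw [hsub, mul_assoc, ← mul_assoc (x ^ i.val), hpow, ← mul_assoc, ← mul_assoc, hy', one_mul]

variable {k : Type u} [Field k]

/-- The diagonal matrix `diag(1, e ^ a, e ^ b)` in `GL(3, k)`. -/
def diagMatrix (e : kˣ) (a b : ℕ) : GL (Fin 3) k where
  val := !![1, 0, 0; 0, (e : k) ^ a, 0; 0, 0, (e : k) ^ b]
  inv := !![1, 0, 0; 0, ((e⁻¹ : kˣ) : k) ^ a, 0; 0, 0, ((e⁻¹ : kˣ) : k) ^ b]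
  val_inv := by
    ext i j
    fin_cases i <;> fin_cases j <;> simp [Matrix.mul_apply, Fin.sum_univ_three]
  inv_val := by
    ext i j
    fin_cases i <;> fin_cases j <;> simp [Matrix.mul_apply, Fin.sum_univ_three]

variable (k) in
/-- The permutation matrix exchanging the last two coordinates. -/
def swapMatrix : GL (Fin 3) k where
  val := !![1, 0, 0; 0, 0, 1; 0, 1, 0]
  inv := !![1, 0, 0; 0, 0, 1; 0, 1, 0]
  val_inv := by
    ext i j
    fin_cases i <;> fin_cases j <;> simp [Matrix.mul_apply, Fin.sum_univ_three]
  inv_val := by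
    ext i j
    fin_cases i <;> fin_cases j <;> simp [Matrix.mul_apply, Fin.sum_univ_three]

/-- The representation `ρ_a` of the dihedral group of order `2 * d` with
`ρ_a(τ) = diag(1, e ^ a, e ^ (d - a))`, where `e = ε ^ 2`, and `ρ_a(η)` the swap of the last two
coordinates; here `τ = r 1` and `η = sr 0`. -/
def dihedralRep (d a : ℕ) [NeZero d] (ε : kˣ) (hε : IsPrimitiveRoot ε (2 * d)) (ha : a ≤ d) :
    DihedralGroup d →* GL (Fin 3) k :=
  dihedralLift d (diagMatrix (ε ^ 2) a (d - a)) (swapMatrix k)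
    (by
      have hε' : (ε : k) ^ (2 * d) = 1 := by
        rw [← Units.val_pow_eq_pow_val, hε.pow_eq_one, Units.val_one]
      have h : ∀ c : ℕ, (((ε : k) ^ 2) ^ c) ^ d = 1 := fun c => by
        rw [← pow_mul, ← pow_mul, ← mul_assoc, mul_right_comm, pow_mul, hε', one_pow]
      have hpow : ∀ m : ℕ, (diagMatrix (ε ^ 2) a (d - a) : Matrix (Fin 3) (Fin 3) k) ^ m =
          !![1, 0, 0; 0, (((ε : k) ^ 2) ^ a) ^ m, 0; 0, 0, (((ε : k) ^ 2) ^ (d - a)) ^ m] := by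
        intro m
        induction m with
        | zero => ext i j; fin_cases i <;> fin_cases j <;> simp
        | succ m ih =>
          rw [pow_succ, ih]
          ext i j
          fin_cases i <;> fin_cases j <;>
            simp [diagMatrix, Matrix.mul_apply, Fin.sum_univ_three, pow_succ]
      refine Units.ext ?_
      rw [Units.val_pow_eq_pow_val, hpow, h, h, Units.val_one]
      ext i j
      fin_cases i <;> fin_cases j <;> simp)
    (by rw [sq]; exact Units.ext (swapMatrix k).val_inv)
    (by
      have h : ((ε : k) ^ 2) ^ a * ((ε : k) ^ 2) ^ (d - a) = 1 := by
        rw [← pow_add, Nat.add_sub_cancel' ha, ← pow_mul, ← Units.val_pow_eq_pow_val,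
          hε.pow_eq_one, Units.val_one]
      have h' := (mul_comm _ _).trans h
      refine Units.ext ?_
      rw [sq]
      ext i j
      simp only [diagMatrix, swapMatrix, Units.val_mul, Units.val_one, Units.val_pow_eq_pow_val]
      fin_cases i <;> fin_cases j <;>
        simp [Matrix.mul_apply, Fin.sum_univ_three, h, h'])

/-- The action of `g ∈ GL(3, k)` on `k[x_0, x_1, x_2]` by the linear substitution
`x_j ↦ ∑ i, g_ij x_i`. -/
def act (g : GL (Fin 3) k) : MvPolynomial (Fin 3) k →ₐ[k] MvPolynomial (Fin 3) k :=
  aeval fun j => ∑ i, C ((g : Matrix (Fin 3) (Fin 3) k) i j) * X i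

/-- The space of invariant forms of degree `N` of a linear group. -/
def invariantForms (G : Subgroup (GL (Fin 3) k)) (N : ℕ) :
    Submodule k (MvPolynomial (Fin 3) k) :=
  homogeneousSubmodule (Fin 3) k N ⊓
    ⨅ g ∈ G, LinearMap.eqLocus (act g).toLinearMap LinearMap.id

/-- The cyclic extension of the dihedral group: the subgroup of `GL(3, k)` generated by the image
of `ρ_a` and the scalar matrix `ε • 1`. -/
def extendedDihedral (d a : ℕ) [NeZero d] (ε : kˣ) (hε : IsPrimitiveRoot ε (2 * d))
    (ha : a ≤ d) : Subgroup (GL (Fin 3) k) :=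
  (dihedralRep d a ε hε ha).range ⊔
    Subgroup.zpowers (Units.map (Matrix.scalar (Fin 3) : k →+* _).toMonoidHom ε)

/-- The monomial `x_0 ^ a₀ * x_1 ^ a₁ * x_2 ^ a₂`. -/
def mono (k : Type u) [Field k] (a₀ a₁ a₂ : ℕ) : MvPolynomial (Fin 3) k :=
  X 0 ^ a₀ * X 1 ^ a₁ * X 2 ^ a₂

/-- The set of forms of degree `2 * d` consisting of the monomials
`x_0^(2d-2c) x_1^c x_2^c` with `0 ≤ c ≤ d` and of the binomials
`x_0^a₀ x_1^a₁ x_2^a₂ + x_0^a₀ x_1^a₂ x_2^a₁` with `a₁ ≠ a₂` whose monomials are invariant under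
the cyclic group generated by `diag(1, e, e ^ (d - 1))`, where `e = ε ^ 2`. -/
def basisForms (d : ℕ) (ε : kˣ) : Set (MvPolynomial (Fin 3) k) :=
  {f | ∃ c ≤ d, f = mono k (2 * d - 2 * c) c c} ∪
  {f | ∃ a₀ a₁ a₂ : ℕ, a₀ + a₁ + a₂ = 2 * d ∧ a₁ ≠ a₂ ∧
    (∀ g ∈ Subgroup.zpowers (diagMatrix (ε ^ 2) 1 (d - 1)),
      act g (mono k a₀ a₁ a₂) = mono k a₀ a₁ a₂) ∧
    f = mono k a₀ a₁ a₂ + mono k a₀ a₂ a₁}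

end Dihedral

end

end GTSystem

open GTSystem

/-! Write `e = ε ^ 2`. Since `a` is a unit modulo `d`, a monomial `x₀^i x₁^j x₂^l` is fixed by
`ρ_a(τ)` exactly when `j ≡ l` mod `d`, whatever `a` is. Symmetrizing under the swap gives
`invariantForms_eq_span`: the invariant forms of degree `2d` are spanned by `basisForms`, whose
elements have disjoint supports. Here `j - l` is `0`, `±d` or `±2d`, so there are at most `(d + 1) +
(⌊d/2⌋ + 1) + 1 ≤ 2d + 1` of them.

For a linear form `L ≠ 0`, the norm `∏ g(L)` over the whole group is an invariant of degree `2d`,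
hence lies in `I`, while the product over `g ≠ 1` is nonzero of degree `2d - 1`, where `I` vanishes.
So `×L` is not injective. As `dim R_{2d} - dim R_{2d-1} = 2d + 1` is at least the number of
generators, it is not surjective either (`not_mulHasMaximalRank`).

The forms `x₀^{2d}`, `x₁^d x₂^d`, `x₁^{2d} + x₂^{2d}` have no common zero, and `x₁^{2d}`, `x₂^{2d}`
are the roots of a monic quadratic over them; so `φ` is a finite morphism. Invariant forms whose
degree is a multiple of `2d` are polynomials in `basisForms` (`mem_adjoin_of_invariant`). Hence
points with the same image contain the same invariants, and primes over the same prime of an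
invariant ring are conjugate: the fibres are orbits.

A deck transformation preserves the chart `x₀ ≠ 0`. With `u = x₁/x₀` and `v = x₂/x₀` it fixes the
constants, `uv` and `u^d + v^d`, which forces it to be dihedral on the chart
(`exists_dihedral_of_fixes`). It then agrees with a group element everywhere, because the chart is
dense and the plane is reduced. -/

namespace GTSystem

noncomputable section

/-! ### Linear substitutions and their effect on monomials and coefficients. -/

section LinearSubstitution

variable {k : Type u} [Field k]

theorem act_X (g : GL (Fin 3) k) (j : Fin 3) :
    act g (X j) = ∑ i, C ((g : Matrix (Fin 3) (Fin 3) k) i j) * X i :=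
  aeval_X _ _

theorem act_one : act (1 : GL (Fin 3) k) = AlgHom.id k _ := by
  ext j : 1
  simp [act_X, Matrix.one_apply]

theorem act_mul (g h : GL (Fin 3) k) : act (g * h) = (act g).comp (act h) := by
  ext j : 1
  simp only [act_X, AlgHom.comp_apply, map_sum, map_mul, algHom_C, Units.val_mul,
    Matrix.mul_apply, Finset.mul_sum, Finset.sum_mul, algebraMap_eq]
  rw [Finset.sum_comm]
  refine Finset.sum_congr rfl fun i _ => Finset.sum_congr rfl fun l _ => ?_
  ring

theorem act_mul_apply (g h : GL (Fin 3) k) (p : MvPolynomial (Fin 3) k) :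
    act (g * h) p = act g (act h p) := by
  rw [act_mul, AlgHom.comp_apply]

theorem act_one_apply (p : MvPolynomial (Fin 3) k) : act (1 : GL (Fin 3) k) p = p := by
  rw [act_one, AlgHom.id_apply]

theorem act_injective (g : GL (Fin 3) k) : Function.Injective (act g) := by
  refine Function.LeftInverse.injective (g := act g⁻¹) fun p => ?_
  rw [← act_mul_apply, inv_mul_cancel, act_one_apply]

theorem IsHomogeneous.act {p : MvPolynomial (Fin 3) k} {n : ℕ} (hp : p.IsHomogeneous n)
    (g : GL (Fin 3) k) : (act g p).IsHomogeneous n := by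
  have := hp.aeval (fun j => ∑ i, C ((g : Matrix (Fin 3) (Fin 3) k) i j) * X i) (n := 1)
    fun j => IsHomogeneous.sum _ _ _ fun i _ => isHomogeneous_C_mul_X _ _
  rwa [one_mul] at this

/-- The subgroup of linear substitutions fixing a polynomial. -/
def fixer (p : MvPolynomial (Fin 3) k) : Subgroup (GL (Fin 3) k) where
  carrier := {g | act g p = p}
  one_mem' := act_one_apply p
  mul_mem' {g h} hg hh := by
    change act (g * h) p = p
    rw [act_mul_apply, show act h p = p from hh, show act g p = p from hg]
  inv_mem' {g} hg := by
    change act g⁻¹ p = p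
    conv_lhs => rw [← show act g p = p from hg]
    rw [← act_mul_apply, inv_mul_cancel, act_one_apply]

theorem mem_fixer {p : MvPolynomial (Fin 3) k} {g : GL (Fin 3) k} :
    g ∈ fixer p ↔ act g p = p := Iff.rfl

theorem mem_invariantForms {G : Subgroup (GL (Fin 3) k)} {N : ℕ} {p : MvPolynomial (Fin 3) k} :
    p ∈ invariantForms G N ↔ p.IsHomogeneous N ∧ G ≤ fixer p := by
  simp [invariantForms, SetLike.le_def, mem_fixer]

theorem act_diagMatrix_mono (e : kˣ) (a b i j l : ℕ) :
    act (diagMatrix e a b) (mono k i j l) =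
      C ((e : k) ^ (a * j + b * l)) * mono k i j l := by
  have h0 : act (diagMatrix e a b) (X 0) = X 0 := by
    simp [act_X, diagMatrix, Fin.sum_univ_three]
  have h1 : act (diagMatrix e a b) (X 1) = C ((e : k) ^ a) * X 1 := by
    simp [act_X, diagMatrix, Fin.sum_univ_three]
  have h2 : act (diagMatrix e a b) (X 2) = C ((e : k) ^ b) * X 2 := by
    simp [act_X, diagMatrix, Fin.sum_univ_three]
  simp only [mono, map_mul, map_pow, h0, h1, h2, mul_pow, pow_add, pow_mul]
  ring

theorem act_swapMatrix_mono (i j l : ℕ) :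
    act (swapMatrix k) (mono k i j l) = mono k i l j := by
  have h0 : act (swapMatrix k) (X 0) = X 0 := by
    simp [act_X, swapMatrix, Fin.sum_univ_three]
  have h1 : act (swapMatrix k) (X 1) = X 2 := by
    simp [act_X, swapMatrix, Fin.sum_univ_three]
  have h2 : act (swapMatrix k) (X 2) = X 1 := by
    simp [act_X, swapMatrix, Fin.sum_univ_three]
  simp only [mono, map_mul, map_pow, h0, h1, h2]
  ring

theorem act_scalar {p : MvPolynomial (Fin 3) k} {n : ℕ} (hp : p.IsHomogeneous n) (c : kˣ) :
    act (Units.map (Matrix.scalar (Fin 3) : k →+* _).toMonoidHom c) p = C ((c : k) ^ n) * p := by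
  have hX : ∀ j, act (Units.map (Matrix.scalar (Fin 3) : k →+* _).toMonoidHom c) (X j) =
      C (c : k) * X j := fun j => by
    simp [act_X, Matrix.diagonal_apply, apply_ite C, ite_mul]
  rw [p.as_sum, map_sum, Finset.mul_sum]
  refine Finset.sum_congr rfl fun m hm => ?_
  have hdeg : m.degree = n := by
    by_contra h
    exact (mem_support_iff.mp hm) (hp.coeff_eq_zero h)
  rw [monomial_eq, map_mul, algHom_C, algebraMap_eq, Finsupp.prod, map_prod]
  simp only [map_pow, hX, mul_pow, Finset.prod_mul_distrib, Finset.prod_pow_eq_pow_sum]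
  rw [← hdeg, Finsupp.degree_apply]
  ring

theorem monomial_eq_mono (m : Fin 3 →₀ ℕ) (c : k) :
    monomial m c = C c * mono k (m 0) (m 1) (m 2) := by
  rw [monomial_eq, mono, Finsupp.prod_fintype _ _ (fun _ => pow_zero _), Fin.prod_univ_three]

theorem eq_sum_mono (p : MvPolynomial (Fin 3) k) :
    p = ∑ m ∈ p.support, p.coeff m • mono k (m 0) (m 1) (m 2) := by
  conv_lhs => rw [p.as_sum]
  simp_rw [monomial_eq_mono, smul_eq_C_mul]

/-- The exponent vector `(i, j, l)`. -/
def expo (i j l : ℕ) : Fin 3 →₀ ℕ := Finsupp.equivFunOnFinite.symm ![i, j, l]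

@[simp] theorem expo_zero (i j l : ℕ) : expo i j l 0 = i := rfl
@[simp] theorem expo_one (i j l : ℕ) : expo i j l 1 = j := rfl
@[simp] theorem expo_two (i j l : ℕ) : expo i j l 2 = l := rfl

theorem expo_self (m : Fin 3 →₀ ℕ) : expo (m 0) (m 1) (m 2) = m := by
  ext i; fin_cases i <;> rfl

theorem expo_inj {i j l i' j' l' : ℕ} :
    expo i j l = expo i' j' l' ↔ i = i' ∧ j = j' ∧ l = l' := by
  refine ⟨fun h => ⟨?_, ?_, ?_⟩, by rintro ⟨rfl, rfl, rfl⟩; rfl⟩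
  · simpa using DFunLike.congr_fun h 0
  · simpa using DFunLike.congr_fun h 1
  · simpa using DFunLike.congr_fun h 2

theorem expo_degree (i j l : ℕ) : (expo i j l).degree = i + j + l := by
  rw [Finsupp.degree_eq_sum, Fin.sum_univ_three]; rfl

theorem mono_eq_monomial (i j l : ℕ) : mono k i j l = monomial (expo i j l) 1 := by
  rw [monomial_eq_mono]; simp

theorem coeff_mono (i j l : ℕ) (m : Fin 3 →₀ ℕ) :
    coeff m (mono k i j l) = if expo i j l = m then 1 else 0 := by
  rw [mono_eq_monomial, coeff_monomial]

theorem isHomogeneous_mono {i j l n : ℕ} (h : i + j + l = n) :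
    (mono k i j l).IsHomogeneous n := by
  rw [mono_eq_monomial]
  exact isHomogeneous_monomial _ (by rw [expo_degree, h])

/-- Diagonal substitutions rescale each coefficient separately, so invariance can be tested on one
monomial of the support at a time. -/
theorem coeff_act_diagMatrix (e : kˣ) (a b : ℕ) (p : MvPolynomial (Fin 3) k)
    (m : Fin 3 →₀ ℕ) :
    coeff m (act (diagMatrix e a b) p) = (e : k) ^ (a * m 1 + b * m 2) * coeff m p := by
  induction p using MvPolynomial.induction_on' with
  | monomial n c =>
    rw [monomial_eq_mono, map_mul, algHom_C, algebraMap_eq, act_diagMatrix_mono, coeff_C_mul,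
      coeff_C_mul, coeff_C_mul, coeff_mono, expo_self]
    split_ifs with h
    · subst h; ring
    · simp
  | add p q hp hq => rw [map_add, coeff_add, hp, hq, coeff_add, mul_add]

/-- A polynomial fixed by the swap of the last two variables lies in a subspace as soon as the
symmetrizations of its monomials do. -/
theorem mem_of_swap_invariant [CharZero k] {p : MvPolynomial (Fin 3) k}
    (S : Submodule k (MvPolynomial (Fin 3) k)) (hp : act (swapMatrix k) p = p)
    (h : ∀ m ∈ p.support, mono k (m 0) (m 1) (m 2) + mono k (m 0) (m 2) (m 1) ∈ S) : p ∈ S := by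
  -- `2p = p + η(p)`, with both copies expanded over the support of `p`; characteristic zero then
  -- permits division by `2`.
  have h2 : (2 : k) • p = ∑ m ∈ p.support,
      p.coeff m • (mono k (m 0) (m 1) (m 2) + mono k (m 0) (m 2) (m 1)) := by
    simp_rw [smul_add]
    rw [Finset.sum_add_distrib, ← eq_sum_mono, two_smul]
    congr 1
    conv_lhs => rw [← hp, eq_sum_mono p]
    simp_rw [map_sum, map_smul, act_swapMatrix_mono]
  rw [← inv_smul_smul₀ (two_ne_zero' k) p, h2]
  exact S.smul_mem _ (S.sum_mem fun m hm => S.smul_mem _ (h m hm))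

end LinearSubstitution

/-! ### Invariant forms of degree `2d`: basis and dimension. -/

section DihedralAction

variable {k : Type u} [Field k] {d a : ℕ} [NeZero d] {ε : kˣ}

theorem dihedralRep_r (hε : IsPrimitiveRoot ε (2 * d)) (ha : a ≤ d) (i : ZMod d) :
    dihedralRep d a ε hε ha (.r i) = diagMatrix (ε ^ 2) a (d - a) ^ i.val := rfl

theorem dihedralRep_sr (hε : IsPrimitiveRoot ε (2 * d)) (ha : a ≤ d) (i : ZMod d) :
    dihedralRep d a ε hε ha (.sr i) =
      swapMatrix k * diagMatrix (ε ^ 2) a (d - a) ^ i.val := rfl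

theorem dihedralRep_r_one (hd : 2 ≤ d) (hε : IsPrimitiveRoot ε (2 * d)) (ha : a ≤ d) :
    dihedralRep d a ε hε ha (.r 1) = diagMatrix (ε ^ 2) a (d - a) := by
  have : Fact (1 < d) := ⟨hd⟩
  rw [dihedralRep_r, ZMod.val_one, pow_one]

theorem dihedralRep_sr_zero (hε : IsPrimitiveRoot ε (2 * d)) (ha : a ≤ d) :
    dihedralRep d a ε hε ha (.sr 0) = swapMatrix k := by
  rw [dihedralRep_sr, ZMod.val_zero, pow_zero, mul_one]

theorem range_dihedralRep_le_fixer (hd : 2 ≤ d) (hε : IsPrimitiveRoot ε (2 * d)) (ha : a ≤ d)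
    {p : MvPolynomial (Fin 3) k} :
    (dihedralRep d a ε hε ha).range ≤ fixer p ↔
      act (diagMatrix (ε ^ 2) a (d - a)) p = p ∧ act (swapMatrix k) p = p := by
  constructor
  · intro h
    refine ⟨h ⟨.r 1, dihedralRep_r_one hd hε ha⟩, h ⟨.sr 0, dihedralRep_sr_zero hε ha⟩⟩
  · rintro ⟨h1, h2⟩ _ ⟨i | i, rfl⟩
    · exact (fixer p).pow_mem (mem_fixer.mpr h1) _
    · exact (fixer p).mul_mem (mem_fixer.mpr h2) ((fixer p).pow_mem (mem_fixer.mpr h1) _)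

/-- Modulo `d` the exponent is `a(i - j)`, and `a` is invertible. The criterion no longer mentions
`a`, which is why `basisForms`, defined with exponent `1`, serves every `a`. -/
theorem pow_eq_one_iff_natCast_eq (hε : IsPrimitiveRoot ε (2 * d)) (ha : a ≤ d)
    (hda : Nat.gcd d a = 1) (i j : ℕ) :
    ((ε ^ 2 : kˣ) : k) ^ (a * i + (d - a) * j) = 1 ↔ (i : ZMod d) = j := by
  have he : IsPrimitiveRoot (ε ^ 2) d :=
    hε.pow (Nat.mul_pos two_pos (NeZero.pos d)) rfl
  rw [← Units.val_pow_eq_pow_val, Units.val_eq_one, he.pow_eq_one_iff_dvd,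
    ← ZMod.natCast_eq_zero_iff]
  have hu : IsUnit (a : ZMod d) := (ZMod.isUnit_iff_coprime a d).mpr (Nat.coprime_comm.mp hda)
  push_cast [ha]
  rw [ZMod.natCast_self, zero_sub, neg_mul, ← sub_eq_add_neg, sub_eq_zero]
  exact hu.mul_right_inj

theorem natCast_eq_of_mem_support (hε : IsPrimitiveRoot ε (2 * d)) (ha : a ≤ d)
    (hda : Nat.gcd d a = 1) {p : MvPolynomial (Fin 3) k}
    (hp : act (diagMatrix (ε ^ 2) a (d - a)) p = p) {m : Fin 3 →₀ ℕ} (hm : m ∈ p.support) :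
    (m 1 : ZMod d) = m 2 := by
  rw [← pow_eq_one_iff_natCast_eq hε ha hda]
  have h := coeff_act_diagMatrix (ε ^ 2) a (d - a) p m
  rw [hp] at h
  exact mul_right_cancel₀ (mem_support_iff.mp hm) (h.symm.trans (one_mul _).symm)

theorem act_diagMatrix_mono_eq_self (hε : IsPrimitiveRoot ε (2 * d)) (ha : a ≤ d)
    (hda : Nat.gcd d a = 1) {i j l : ℕ} (h : (j : ZMod d) = l) :
    act (diagMatrix (ε ^ 2) a (d - a)) (mono k i j l) = mono k i j l := by
  rw [act_diagMatrix_mono, (pow_eq_one_iff_natCast_eq hε ha hda j l).mpr h, C_1, one_mul]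

theorem zpowers_act_mono_iff (hd : 1 ≤ d) (hε : IsPrimitiveRoot ε (2 * d)) (i j l : ℕ) :
    (∀ g ∈ Subgroup.zpowers (diagMatrix (ε ^ 2) 1 (d - 1)),
      act g (mono k i j l) = mono k i j l) ↔ (j : ZMod d) = l := by
  rw [show (∀ g ∈ Subgroup.zpowers (diagMatrix (ε ^ 2) 1 (d - 1)),
      act g (mono k i j l) = mono k i j l) ↔
      Subgroup.zpowers (diagMatrix (ε ^ 2) 1 (d - 1)) ≤ fixer (mono k i j l) from Iff.rfl,
    Subgroup.zpowers_le, mem_fixer]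
  constructor
  · intro h
    have := natCast_eq_of_mem_support hε hd (Nat.gcd_one_right d) h (m := expo i j l)
      (by rw [mem_support_iff, coeff_mono, if_pos rfl]; exact one_ne_zero)
    simpa using this
  · exact act_diagMatrix_mono_eq_self hε hd (Nat.gcd_one_right d)

theorem mem_basisForms (hd : 1 ≤ d) (hε : IsPrimitiveRoot ε (2 * d))
    {f : MvPolynomial (Fin 3) k} :
    f ∈ basisForms d ε ↔ (∃ c ≤ d, f = mono k (2 * d - 2 * c) c c) ∨
      ∃ i j l : ℕ, i + j + l = 2 * d ∧ j ≠ l ∧ (j : ZMod d) = l ∧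
        f = mono k i j l + mono k i l j := by
  simp only [basisForms, zpowers_act_mono_iff hd hε]
  rfl

theorem symm_mono_mem_span_basisForms (hd : 1 ≤ d) (hε : IsPrimitiveRoot ε (2 * d))
    {i j l : ℕ} (h : i + j + l = 2 * d) (hjl : (j : ZMod d) = l) :
    mono k i j l + mono k i l j ∈ Submodule.span k (basisForms d ε) := by
  by_cases hne : j = l
  · subst hne
    have : mono k i j j ∈ Submodule.span k (basisForms d ε) := by
      refine Submodule.subset_span ((mem_basisForms hd hε).mpr (Or.inl ⟨j, by omega, ?_⟩))
      congr 1
      omega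
    exact add_mem this this
  · exact Submodule.subset_span ((mem_basisForms hd hε).mpr
      (Or.inr ⟨i, j, l, h, hne, hjl, rfl⟩))

theorem basisForms_isHomogeneous (hd : 1 ≤ d) (hε : IsPrimitiveRoot ε (2 * d))
    {f : MvPolynomial (Fin 3) k} (hf : f ∈ basisForms d ε) : f.IsHomogeneous (2 * d) := by
  obtain ⟨c, hc, rfl⟩ | ⟨i, j, l, h, -, -, rfl⟩ := (mem_basisForms hd hε).mp hf
  · exact isHomogeneous_mono (by omega)
  · exact (isHomogeneous_mono h).add (isHomogeneous_mono (by omega))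

theorem basisForms_invariant (hd : 1 ≤ d) (hε : IsPrimitiveRoot ε (2 * d)) (ha : a ≤ d)
    (hda : Nat.gcd d a = 1) {f : MvPolynomial (Fin 3) k} (hf : f ∈ basisForms d ε) :
    act (diagMatrix (ε ^ 2) a (d - a)) f = f ∧ act (swapMatrix k) f = f := by
  obtain ⟨c, hc, rfl⟩ | ⟨i, j, l, h, -, hjl, rfl⟩ := (mem_basisForms hd hε).mp hf
  · exact ⟨act_diagMatrix_mono_eq_self hε ha hda rfl, act_swapMatrix_mono _ _ _⟩
  · rw [map_add, map_add, act_swapMatrix_mono, act_swapMatrix_mono,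
      act_diagMatrix_mono_eq_self hε ha hda hjl, act_diagMatrix_mono_eq_self hε ha hda hjl.symm]
    exact ⟨rfl, add_comm _ _⟩

/-- Over the forms of degree divisible by `2d`, the scalar `ε` acts trivially. -/
theorem mem_invariantForms_extendedDihedral (hd : 2 ≤ d) (hε : IsPrimitiveRoot ε (2 * d))
    (ha : a ≤ d) {p : MvPolynomial (Fin 3) k} :
    p ∈ invariantForms (extendedDihedral d a ε hε ha) (2 * d) ↔ p.IsHomogeneous (2 * d) ∧
      act (diagMatrix (ε ^ 2) a (d - a)) p = p ∧ act (swapMatrix k) p = p := by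
  rw [mem_invariantForms]
  refine and_congr_right fun hp => ?_
  rw [extendedDihedral, sup_le_iff, range_dihedralRep_le_fixer hd hε ha, Subgroup.zpowers_le,
    mem_fixer, act_scalar hp]
  refine and_iff_left ?_
  rw [← Units.val_pow_eq_pow_val, hε.pow_eq_one, Units.val_one, C_1, one_mul]

theorem invariantForms_eq_span [CharZero k] (hd : 2 ≤ d) (hε : IsPrimitiveRoot ε (2 * d))
    (ha : a ≤ d) (hda : Nat.gcd d a = 1) :
    invariantForms (extendedDihedral d a ε hε ha) (2 * d) =
      Submodule.span k (basisForms d ε) := by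
  have hd' : 1 ≤ d := by omega
  apply le_antisymm
  · intro p hp
    obtain ⟨hp, hτ, hη⟩ := (mem_invariantForms_extendedDihedral hd hε ha).mp hp
    refine mem_of_swap_invariant _ hη fun m hm => symm_mono_mem_span_basisForms hd' hε ?_
      (natCast_eq_of_mem_support hε ha hda hτ hm)
    by_contra h
    refine (mem_support_iff.mp hm) (hp.coeff_eq_zero ?_)
    rwa [← expo_self m, expo_degree]
  · refine Submodule.span_le.mpr fun f hf => ?_
    exact (mem_invariantForms_extendedDihedral hd hε ha).mpr
      ⟨basisForms_isHomogeneous hd' hε hf, basisForms_invariant hd' hε ha hda hf⟩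

/-- The unique element of `basisForms` in which the monomial with exponent `m` occurs. -/
def orbitForm (k : Type u) [Field k] (m : Fin 3 →₀ ℕ) : MvPolynomial (Fin 3) k :=
  if m 1 = m 2 then mono k (m 0) (m 1) (m 2)
  else mono k (m 0) (m 1) (m 2) + mono k (m 0) (m 2) (m 1)

/-- A swap orbit is determined by any monomial in it, so distinct basis forms have disjoint
supports. -/
theorem basisForms_coeff (hd : 1 ≤ d) (hε : IsPrimitiveRoot ε (2 * d))
    {f : MvPolynomial (Fin 3) k} (hf : f ∈ basisForms d ε) {m : Fin 3 →₀ ℕ}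
    (hm : coeff m f ≠ 0) : f = orbitForm k m := by
  obtain ⟨c, hc, rfl⟩ | ⟨i, j, l, h, hne, -, rfl⟩ := (mem_basisForms hd hε).mp hf
  · rw [coeff_mono] at hm
    obtain rfl : expo _ _ _ = m := by by_contra h; exact hm (if_neg h)
    rw [orbitForm, if_pos (by simp)]; simp
  · rw [coeff_add, coeff_mono, coeff_mono] at hm
    by_cases h1 : expo i j l = m
    · subst h1
      rw [orbitForm, if_neg (by simpa using hne)]; simp
    · by_cases h2 : expo i l j = m
      · subst h2
        rw [orbitForm, if_neg (by simpa using hne.symm), add_comm]; simp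
      · exact absurd (by rw [if_neg h1, if_neg h2, add_zero]) hm

theorem basisForms_ne_zero [CharZero k] (hd : 1 ≤ d) (hε : IsPrimitiveRoot ε (2 * d))
    {f : MvPolynomial (Fin 3) k} (hf : f ∈ basisForms d ε) : f ≠ 0 := by
  intro h0
  obtain ⟨c, hc, rfl⟩ | ⟨i, j, l, h, hne, -, rfl⟩ := (mem_basisForms hd hε).mp hf
  · have := congrArg (coeff (expo (2 * d - 2 * c) c c)) h0
    simp [coeff_mono] at this
  · have := congrArg (coeff (expo i j l)) h0
    rw [coeff_add, coeff_mono, coeff_mono, if_pos rfl, if_neg] at this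
    · simp at this
    · rw [expo_inj]
      exact fun h => hne h.2.2

theorem linearIndepOn_basisForms [CharZero k] (hd : 1 ≤ d) (hε : IsPrimitiveRoot ε (2 * d)) :
    LinearIndepOn k id (basisForms (k := k) d ε) := by
  rw [LinearIndepOn, linearIndependent_iff']
  intro s c hs f hf
  -- By disjointness of supports, the coefficient at a monomial `m` of `f` sees only the term of `f`
  -- in a linear relation.
  obtain ⟨m, hm⟩ := MvPolynomial.ne_zero_iff.mp (basisForms_ne_zero hd hε f.2)
  have h := congrArg (coeff m) hs
  rw [coeff_sum, coeff_zero, Finset.sum_eq_single f] at h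
  · simpa [hm] using h
  · intro g _ hgf
    by_contra hg
    rw [coeff_smul] at hg
    refine hgf (Subtype.ext ?_)
    rw [basisForms_coeff hd hε f.2 hm]
    exact basisForms_coeff hd hε g.2 fun h => hg (by rw [id, h, smul_zero])
  · exact fun h => absurd hf h

/-- The difference of the last two exponents is a multiple of `d` between `-2d` and `2d`. The three
pieces correspond to its absolute value being `0`, `d` or `2d`. -/
theorem basisForms_subset (hd : 1 ≤ d) (hε : IsPrimitiveRoot ε (2 * d)) :
    basisForms (k := k) d ε ⊆
      (fun c => mono k (2 * d - 2 * c) c c) '' Set.Iio (d + 1) ∪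
        (fun l => mono k (d - 2 * l) (l + d) l + mono k (d - 2 * l) l (l + d)) ''
          Set.Iio (d / 2 + 1) ∪
        {mono k 0 (2 * d) 0 + mono k 0 0 (2 * d)} := by
  intro f hf
  obtain ⟨c, hc, rfl⟩ | ⟨i, j, l, h, hne, hjl, rfl⟩ := (mem_basisForms hd hε).mp hf
  · exact Or.inl (Or.inl ⟨c, Nat.lt_succ_of_le hc, rfl⟩)
  · wlog hlj : l < j generalizing j l
    · rw [add_comm (mono k i j l)]
      exact this l j (by omega) hne.symm hjl.symm
        ((mem_basisForms hd hε).mpr (Or.inr ⟨i, l, j, by omega, hne.symm, hjl.symm, rfl⟩))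
        (by omega)
    have hdvd : d ∣ j - l := (Nat.modEq_iff_dvd' hlj.le).mp
      ((ZMod.natCast_eq_natCast_iff _ _ _).mp hjl.symm)
    obtain ⟨q, hq⟩ := hdvd
    have hq0 : q ≠ 0 := by rintro rfl; omega
    have hq2 : q ≤ 2 := by
      by_contra hq2
      have : d * 3 ≤ d * q := Nat.mul_le_mul_left _ (by omega)
      omega
    obtain rfl | rfl : q = 1 ∨ q = 2 := by omega
    · have hl : l ∈ Set.Iio (d / 2 + 1) := by rw [Set.mem_Iio]; omega
      refine Or.inl (Or.inr ⟨l, hl, ?_⟩)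
      rw [show i = d - 2 * l by omega, show j = l + d by omega]
    · refine Or.inr ?_
      rw [Set.mem_singleton_iff, show i = 0 by omega, show l = 0 by omega,
        show j = 2 * d by omega]

theorem finite_basisForms (hd : 1 ≤ d) (hε : IsPrimitiveRoot ε (2 * d)) :
    (basisForms (k := k) d ε).Finite :=
  ((((Set.finite_Iio _).image _).union ((Set.finite_Iio _).image _)).union
    (Set.finite_singleton _)).subset (basisForms_subset hd hε)

/-- The bound `(d + 1) + (⌊d/2⌋ + 1) + 1 ≤ 2d + 1` is where `d ≥ 3` enters. -/
theorem ncard_basisForms_le (hd : 3 ≤ d) (hε : IsPrimitiveRoot ε (2 * d)) :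
    (basisForms (k := k) d ε).ncard ≤ 2 * d + 1 := by
  have h1 := Set.ncard_le_ncard (basisForms_subset (k := k) (by omega) hε)
    ((((Set.finite_Iio _).image _).union ((Set.finite_Iio _).image _)).union
      (Set.finite_singleton _))
  have h2 := h1.trans (Set.ncard_union_le _ _)
  have h3 := h2.trans (Nat.add_le_add_right (Set.ncard_union_le _ _) _)
  have h4 := h3.trans (Nat.add_le_add_right (Nat.add_le_add
    (Set.ncard_image_le (Set.finite_Iio _)) (Set.ncard_image_le (Set.finite_Iio _))) _)
  have hI : ∀ n : ℕ, (Set.Iio n).ncard = n := fun n => by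
    rw [Set.ncard_eq_toFinset_card', Set.toFinset_Iio, Nat.card_Iio]
  rw [Set.ncard_singleton, hI, hI] at h4
  omega

theorem finrank_invariantForms [CharZero k] (hd : 2 ≤ d) (hε : IsPrimitiveRoot ε (2 * d))
    (ha : a ≤ d) (hda : Nat.gcd d a = 1) :
    Module.finrank k (invariantForms (extendedDihedral d a ε hε ha) (2 * d)) =
      (basisForms (k := k) d ε).ncard := by
  have := (finite_basisForms (k := k) (d := d) (by omega) hε).fintype
  rw [invariantForms_eq_span hd hε ha hda,
    finrank_span_set_eq_card (linearIndepOn_basisForms (by omega) hε),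
    Set.ncard_eq_toFinset_card']

end DihedralAction

end

end GTSystem

namespace GTSystem

noncomputable section

/-! ### Ideals generated in a single degree, and failure of maximal rank. -/

section GradedIdeal

variable {k : Type u} [Field k] {n : ℕ}

attribute [local instance] MvPolynomial.gradedAlgebra

/-- The degree `N` part of an ideal generated by forms of degree `N` is the span of the
generators, and there is nothing in lower degrees. -/
theorem homogeneousComponent_of_mem_span {S : Set (MvPolynomial (Fin n) k)} {N : ℕ}
    (hS : ∀ f ∈ S, f.IsHomogeneous N) {p : MvPolynomial (Fin n) k} (hp : p ∈ Ideal.span S) :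
    homogeneousComponent N p ∈ Submodule.span k S ∧
      ∀ j < N, homogeneousComponent j p = 0 := by
  obtain ⟨m, f, g, rfl⟩ := Submodule.mem_span_set'.mp hp
  have hcomp : ∀ (j : ℕ) (q : MvPolynomial (Fin n) k),
      homogeneousComponent j q = (DirectSum.decompose (homogeneousSubmodule (Fin n) k) q j :) :=
    fun j q => (decomposition.decompose'_apply q j).symm
  refine ⟨?_, fun j hj => ?_⟩
  · rw [map_sum]
    refine Submodule.sum_mem _ fun i _ => ?_
    rw [smul_eq_mul, hcomp, DirectSum.coe_decompose_mul_of_right_mem_of_le _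
      (hS _ (g i).2) le_rfl, Nat.sub_self, ← hcomp, homogeneousComponent_zero, ← smul_eq_C_mul]
    exact Submodule.smul_mem _ _ (Submodule.subset_span (g i).2)
  · rw [map_sum]
    refine Finset.sum_eq_zero fun i _ => ?_
    rw [smul_eq_mul, hcomp, DirectSum.coe_decompose_mul_of_right_mem_of_not_le _
      (hS _ (g i).2) (not_le.mpr hj)]

theorem mem_span_of_mem_ideal_span {S : Set (MvPolynomial (Fin n) k)} {N : ℕ}
    (hS : ∀ f ∈ S, f.IsHomogeneous N) {p : MvPolynomial (Fin n) k} (hp : p ∈ Ideal.span S)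
    (hN : p.IsHomogeneous N) : p ∈ Submodule.span k S := by
  have := (homogeneousComponent_of_mem_span hS hp).1
  rwa [homogeneousComponent_eq_self hN] at this

theorem eq_zero_of_mem_ideal_span {S : Set (MvPolynomial (Fin n) k)} {N j : ℕ} (hj : j < N)
    (hS : ∀ f ∈ S, f.IsHomogeneous N) {p : MvPolynomial (Fin n) k} (hp : p ∈ Ideal.span S)
    (hpj : p.IsHomogeneous j) : p = 0 := by
  have := (homogeneousComponent_of_mem_span hS hp).2 j hj
  rwa [homogeneousComponent_eq_self hpj] at this

instance finite_homogeneousSubmodule (j : ℕ) :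
    Module.Finite k (homogeneousSubmodule (Fin n) k j) :=
  Module.Finite.iff_fg.mpr (homogeneousSubmodule_fg (Fin n) k j)

theorem finrank_homogeneousSubmodule (j : ℕ) :
    Module.finrank k (homogeneousSubmodule (Fin n) k j) = (n + j - 1).choose j := by
  have hset : {m : Fin n →₀ ℕ | m.degree = j} =
      ((Finset.univ : Finset (Fin n)).finsuppAntidiag j : Set (Fin n →₀ ℕ)) := by
    ext m
    simp [Finsupp.degree_eq_sum]
  rw [homogeneousSubmodule_eq_finsupp_supported, hset,
    (AddMonoidAlgebra.supportedEquivFinsupp _).finrank_eq, Module.finrank_finsupp_self]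
  simp [Finset.card_finsuppAntidiag_nat_eq_choose]

/-- Multiplication by `L` is not injective in degree `j`, and the dimensions do not allow it to be
surjective. -/
theorem not_mulHasMaximalRank {S : Set (MvPolynomial (Fin n) k)} {j : ℕ}
    (hS : ∀ f ∈ S, f.IsHomogeneous (j + 1)) (hfin : S.Finite)
    (hcard : Module.finrank k (homogeneousSubmodule (Fin n) k j) + S.ncard ≤
      Module.finrank k (homogeneousSubmodule (Fin n) k (j + 1)))
    {L : MvPolynomial (Fin n) k} (hL : L.IsHomogeneous 1) {q : MvPolynomial (Fin n) k}
    (hq : q.IsHomogeneous j) (hq0 : q ≠ 0) (hLq : L * q ∈ Ideal.span S) :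
    ¬ MulHasMaximalRank (Ideal.span S) L j := by
  have := hfin.fintype
  rintro (hinj | hsurj)
  · refine hq0 (eq_zero_of_mem_ideal_span (Nat.lt_succ_self j) hS ?_ hq)
    rw [← Ideal.Quotient.eq_zero_iff_mem]
    refine hinj ⟨q, hq, rfl⟩ (zero_mem _) ?_
    change Ideal.Quotient.mk _ L * Ideal.Quotient.mk _ q = _ * 0
    rw [← map_mul, mul_zero, Ideal.Quotient.eq_zero_iff_mem]
    exact hLq
  -- If `×L` were onto, then `(r, w) ↦ L r + w` from `R_j × W` would cover `R_{j+1}`. It has the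
  -- kernel element `(q, -L q)` with `q ≠ 0`, so `dim R_{j+1} < dim R_j + dim W`, against `hcard`.
  · set W := Submodule.span k S with hW
    have hWfin : Module.Finite k W := FiniteDimensional.span_of_finite k hfin
    let f : homogeneousSubmodule (Fin n) k j × W →ₗ[k] MvPolynomial (Fin n) k :=
      ((LinearMap.mulLeft k L).comp (Submodule.subtype _)).coprod W.subtype
    have hrange : homogeneousSubmodule (Fin n) k (j + 1) ≤ LinearMap.range f := by
      intro p hp
      obtain ⟨_, ⟨r, hr, rfl⟩, hrp⟩ := hsurj (a := Ideal.Quotient.mk _ p) ⟨p, hp, rfl⟩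
      change Ideal.Quotient.mk _ L * Ideal.Quotient.mk _ r = _ at hrp
      rw [← map_mul, eq_comm, Ideal.Quotient.eq] at hrp
      have hLr : (L * r).IsHomogeneous (j + 1) := by
        rw [add_comm]
        exact hL.mul hr
      refine ⟨(⟨r, hr⟩, ⟨p - L * r, mem_span_of_mem_ideal_span hS hrp (hp.sub hLr)⟩), ?_⟩
      simp [f]
    have hLq' : (L * q).IsHomogeneous (j + 1) := by
      rw [add_comm]
      exact hL.mul hq
    have hker : LinearMap.ker f ≠ ⊥ := by
      intro h
      have hmem : ((⟨q, hq⟩, -⟨L * q, mem_span_of_mem_ideal_span hS hLq hLq'⟩) :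
          homogeneousSubmodule (Fin n) k j × W) ∈ LinearMap.ker f := by
        simp [f]
      rw [h, Submodule.mem_bot, Prod.ext_iff] at hmem
      exact hq0 (congrArg Subtype.val hmem.1)
    have h1 := LinearMap.finrank_range_add_finrank_ker f
    have h2 := Submodule.finrank_mono hrange
    have h3 : 0 < Module.finrank k (LinearMap.ker f) := by
      rw [Nat.pos_iff_ne_zero]
      exact fun h => hker (Submodule.finrank_eq_zero.mp h)
    have h4 : Module.finrank k W ≤ S.ncard := by
      rw [Set.ncard_eq_toFinset_card']
      exact finrank_span_le_card S
    rw [Module.finrank_prod] at h1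
    omega

/-- Nilpotent variables are integral over `k`, so the quotient is integral and finitely generated,
hence finite-dimensional. -/
theorem isArtinianRing_quotient {I : Ideal (MvPolynomial (Fin n) k)}
    (h : ∀ i, ∃ N, X i ^ N ∈ I) : IsArtinianRing (MvPolynomial (Fin n) k ⧸ I) := by
  have hint : ∀ p : MvPolynomial (Fin n) k, IsIntegral k (Ideal.Quotient.mk I p) := by
    intro p
    induction p using MvPolynomial.induction_on with
    | C c => exact isIntegral_algebraMap
    | add p q hp hq => rw [map_add]; exact hp.add hq
    | mul_X p i hp =>
      obtain ⟨N, hN⟩ := h i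
      rw [map_mul]
      -- The exponent `N + 1` is positive even when `N = 0`.
      refine hp.mul (IsIntegral.of_pow (n := N + 1) (Nat.succ_pos _) ?_)
      rw [← map_pow, Ideal.Quotient.eq_zero_iff_mem.mpr]
      · exact isIntegral_zero
      · rw [pow_succ]; exact I.mul_mem_right _ hN
  have : Algebra.IsIntegral k (MvPolynomial (Fin n) k ⧸ I) :=
    ⟨fun x => by obtain ⟨p, rfl⟩ := Ideal.Quotient.mk_surjective x; exact hint p⟩
  have : Module.Finite k (MvPolynomial (Fin n) k ⧸ I) := Algebra.IsIntegral.finite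
  exact IsArtinianRing.of_finite k _

end GradedIdeal

/-! ### The ideal of the basis forms: artinian, not monomial, without the WLP. -/

section DihedralIdeal

variable {k : Type u} [Field k] {d a : ℕ} [NeZero d] {ε : kˣ}

theorem X_zero_pow_mem_basisForms (hd : 1 ≤ d) (hε : IsPrimitiveRoot ε (2 * d)) :
    (X 0 ^ (2 * d) : MvPolynomial (Fin 3) k) ∈ basisForms d ε :=
  (mem_basisForms hd hε).mpr (Or.inl ⟨0, Nat.zero_le _, by simp [mono]⟩)

theorem X_one_pow_mul_mem_basisForms (hd : 1 ≤ d) (hε : IsPrimitiveRoot ε (2 * d)) :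
    (X 1 ^ d * X 2 ^ d : MvPolynomial (Fin 3) k) ∈ basisForms d ε :=
  (mem_basisForms hd hε).mpr (Or.inl ⟨d, le_rfl, by simp [mono]⟩)

theorem X_one_pow_add_mem_basisForms (hd : 1 ≤ d) (hε : IsPrimitiveRoot ε (2 * d)) :
    (X 1 ^ (2 * d) + X 2 ^ (2 * d) : MvPolynomial (Fin 3) k) ∈ basisForms d ε :=
  (mem_basisForms hd hε).mpr (Or.inr ⟨0, 2 * d, 0, by simp, by omega, by simp, by simp [mono]⟩)

theorem isArtinianRing_basisForms (hd : 1 ≤ d) (hε : IsPrimitiveRoot ε (2 * d)) :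
    IsArtinianRing (MvPolynomial (Fin 3) k ⧸ Ideal.span (basisForms (k := k) d ε)) := by
  set I := Ideal.span (basisForms (k := k) d ε)
  have h0 : _ ∈ I := Ideal.subset_span (X_zero_pow_mem_basisForms hd hε)
  have h1 : _ ∈ I := Ideal.subset_span (X_one_pow_mul_mem_basisForms hd hε)
  have h2 : _ ∈ I := Ideal.subset_span (X_one_pow_add_mem_basisForms hd hε)
  refine isArtinianRing_quotient fun i => ?_
  fin_cases i
  · exact ⟨_, h0⟩
  · refine ⟨3 * d, ?_⟩
    -- `x₁^{3d} = x₁^d (x₁^{2d} + x₂^{2d}) - x₂^d (x₁^d x₂^d)`, and symmetrically for `x₂`.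
    have := I.sub_mem (I.mul_mem_left (X 1 ^ d) h2) (I.mul_mem_left (X 2 ^ d) h1)
    convert this using 1
    change (X 1 : MvPolynomial (Fin 3) k) ^ (3 * d) = _
    ring
  · refine ⟨3 * d, ?_⟩
    have := I.sub_mem (I.mul_mem_left (X 2 ^ d) h2) (I.mul_mem_left (X 1 ^ d) h1)
    convert this using 1
    change (X 2 : MvPolynomial (Fin 3) k) ^ (3 * d) = _
    ring

theorem swap_invariant_of_mem_ideal (hd : 1 ≤ d) (hε : IsPrimitiveRoot ε (2 * d))
    {p : MvPolynomial (Fin 3) k} (hp : p ∈ Ideal.span (basisForms (k := k) d ε))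
    (hN : p.IsHomogeneous (2 * d)) : act (swapMatrix k) p = p := by
  have h := mem_span_of_mem_ideal_span (fun f => basisForms_isHomogeneous hd hε) hp hN
  refine (Submodule.span_le (p := LinearMap.eqLocus (act (swapMatrix k)).toLinearMap
    LinearMap.id)).mpr (fun f hf => ?_) h
  exact (basisForms_invariant (a := 1) hd hε hd (Nat.gcd_one_right d) hf).2

/-- A monomial ideal contains every monomial of its elements, so it would contain `x₁^{2d}`. But the
degree `2d` part of the ideal is spanned by forms symmetric in `x₁, x₂`. -/
theorem not_isMonomialIdeal (hd : 1 ≤ d) (hε : IsPrimitiveRoot ε (2 * d)) :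
    ¬ IsMonomialIdeal (Ideal.span (basisForms (k := k) d ε)) := by
  rintro ⟨S, hS⟩
  have h2 : _ ∈ Ideal.span _ := Ideal.subset_span (X_one_pow_add_mem_basisForms (k := k) hd hε)
  rw [hS] at h2
  have hm : mono k 0 (2 * d) 0 ∈ Ideal.span ((fun s => monomial s (1 : k)) '' S) := by
    rw [mem_ideal_span_monomial_image] at h2 ⊢
    intro m hm
    rw [mem_support_iff, coeff_mono] at hm
    obtain rfl : expo _ _ _ = m := by by_contra h; exact hm (if_neg h)
    refine h2 _ ?_
    rw [mem_support_iff, show (X 1 ^ (2 * d) + X 2 ^ (2 * d) : MvPolynomial (Fin 3) k) =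
      mono k 0 (2 * d) 0 + mono k 0 0 (2 * d) by simp [mono], coeff_add, coeff_mono, coeff_mono,
      if_pos rfl, if_neg (by rw [expo_inj]; omega)]
    simp
  rw [← hS] at hm
  have h := swap_invariant_of_mem_ideal hd hε hm (isHomogeneous_mono (by omega))
  rw [act_swapMatrix_mono, mono_eq_monomial, mono_eq_monomial] at h
  have := (expo_inj.mp (monomial_left_injective (one_ne_zero) h))
  omega

/-- Restoring the factor `g = 1` turns the product into the norm of `L`, an invariant form of degree
`2d`. -/
theorem prod_act_mem (hd : 2 ≤ d) (hε : IsPrimitiveRoot ε (2 * d)) (ha : a ≤ d)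
    [CharZero k] (hda : Nat.gcd d a = 1) {L : MvPolynomial (Fin 3) k} (hL : L.IsHomogeneous 1) :
    L * ∏ g ∈ Finset.univ.erase (1 : DihedralGroup d), act (dihedralRep d a ε hε ha g) L ∈
      Ideal.span (basisForms (k := k) d ε) := by
  have h1 : L * ∏ g ∈ Finset.univ.erase (1 : DihedralGroup d),
      act (dihedralRep d a ε hε ha g) L = ∏ g, act (dihedralRep d a ε hε ha g) L := by
    conv_lhs => enter [1]; rw [← act_one_apply L, ← map_one (dihedralRep d a ε hε ha)]
    exact Finset.mul_prod_erase _ (fun g => act (dihedralRep d a ε hε ha g) L)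
      (Finset.mem_univ 1)
  rw [h1]
  refine Submodule.span_subset_span k _ _ ?_
  rw [SetLike.mem_coe, ← invariantForms_eq_span hd hε ha hda,
    mem_invariantForms_extendedDihedral hd hε, ← range_dihedralRep_le_fixer hd hε ha]
  refine ⟨?_, ?_⟩
  · have := IsHomogeneous.prod Finset.univ (fun g => act (dihedralRep d a ε hε ha g) L)
      (fun _ => 1) fun g _ => IsHomogeneous.act hL _
    simpa [DihedralGroup.card] using this
  · rintro _ ⟨h, rfl⟩
    rw [mem_fixer, map_prod]
    -- Acting by `h` only permutes the factors of the norm, by left translation.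
    refine Fintype.prod_equiv (Equiv.mulLeft h) _ _ fun g => ?_
    rw [← act_mul_apply, ← map_mul]
    rfl

theorem prod_erase_act_isHomogeneous (hε : IsPrimitiveRoot ε (2 * d)) (ha : a ≤ d)
    {L : MvPolynomial (Fin 3) k} (hL : L.IsHomogeneous 1) :
    (∏ g ∈ Finset.univ.erase (1 : DihedralGroup d),
      act (dihedralRep d a ε hε ha g) L).IsHomogeneous (2 * d - 1) := by
  have := IsHomogeneous.prod (Finset.univ.erase (1 : DihedralGroup d))
    (fun g => act (dihedralRep d a ε hε ha g) L) (fun _ => 1) fun g _ => IsHomogeneous.act hL _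
  simpa [DihedralGroup.card, Finset.card_erase_of_mem] using this

theorem prod_erase_act_ne_zero (hε : IsPrimitiveRoot ε (2 * d)) (ha : a ≤ d)
    {L : MvPolynomial (Fin 3) k} (hL0 : L ≠ 0) :
    ∏ g ∈ Finset.univ.erase (1 : DihedralGroup d), act (dihedralRep d a ε hε ha g) L ≠ 0 :=
  Finset.prod_ne_zero_iff.mpr fun _ _ => (map_ne_zero_iff _ (act_injective _)).mpr hL0

theorem prod_erase_act_notMem (hd : 1 ≤ d) (hε : IsPrimitiveRoot ε (2 * d)) (ha : a ≤ d)
    {L : MvPolynomial (Fin 3) k} (hL : L.IsHomogeneous 1) (hL0 : L ≠ 0) :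
    ∏ g ∈ Finset.univ.erase (1 : DihedralGroup d), act (dihedralRep d a ε hε ha g) L ∉
      Ideal.span (basisForms (k := k) d ε) := fun h =>
  prod_erase_act_ne_zero hε ha hL0 (eq_zero_of_mem_ideal_span (by omega)
    (fun _ => basisForms_isHomogeneous hd hε) h (prod_erase_act_isHomogeneous hε ha hL))

theorem failsWLP_basisForms [CharZero k] (hd : 3 ≤ d) (hε : IsPrimitiveRoot ε (2 * d)) :
    FailsWLPInDegree (Ideal.span (basisForms (k := k) d ε)) (2 * d - 1) := by
  have hd' : 1 ≤ d := by omega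
  have hN : 2 * d - 1 + 1 = 2 * d := by omega
  intro L hL
  obtain ⟨q, hq, hq0, hLq⟩ : ∃ q : MvPolynomial (Fin 3) k, q.IsHomogeneous (2 * d - 1) ∧
      q ≠ 0 ∧ L * q ∈ Ideal.span (basisForms (k := k) d ε) := by
    by_cases hL0 : L = 0
    · refine ⟨X 0 ^ (2 * d - 1), isHomogeneous_X_pow _ _, pow_ne_zero _ (X_ne_zero _), ?_⟩
      rw [hL0, zero_mul]
      exact zero_mem _
    -- The ideal does not depend on `a`, so the norm for the representation with `a = 1` is good
    -- enough.
    · exact ⟨_, prod_erase_act_isHomogeneous hε hd' hL, prod_erase_act_ne_zero hε hd' hL0,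
        prod_act_mem (by omega) hε hd' (Nat.gcd_one_right d) hL⟩
  refine not_mulHasMaximalRank (fun f hf => ?_) (finite_basisForms hd' hε) ?_ hL hq hq0 hLq
  · rw [hN]
    exact basisForms_isHomogeneous hd' hε hf
  · have hcard := ncard_basisForms_le (k := k) hd hε
    rw [finrank_homogeneousSubmodule, finrank_homogeneousSubmodule]
    -- With `M = 2d - 1`, Pascal's rule gives `dim R_{M+1} = dim R_M + (M + 2)`, and `M + 2 = 2d +
    -- 1` bounds the number of generators.
    obtain ⟨M, hM⟩ : ∃ M, 2 * d - 1 = M := ⟨_, rfl⟩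
    rw [hM, show 3 + (M + 1) - 1 = M + 2 + 1 by omega, show 3 + M - 1 = M + 2 by omega,
      Nat.choose_succ_succ, Nat.choose_succ_self_right]
    omega

end DihedralIdeal

end

end GTSystem

namespace GTSystem

noncomputable section

/-! ### Invariants of degree divisible by `2d` are polynomials in the basis forms. -/

section InvariantRing

variable {k : Type u} [Field k] {d a : ℕ} [NeZero d] {ε : kˣ}

theorem symm_mono_mem_adjoin (hd : 1 ≤ d) (hε : IsPrimitiveRoot ε (2 * d))
    {i j l : ℕ} (h : i + j + l = 2 * d) (hjl : (j : ZMod d) = l) :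
    mono k i j l + mono k i l j ∈ Algebra.adjoin k (basisForms (k := k) d ε) :=
  Algebra.span_le_adjoin k _ (symm_mono_mem_span_basisForms hd hε h hjl)

theorem X_zero_pow_mul_pow_mem_adjoin (hd : 1 ≤ d) (hε : IsPrimitiveRoot ε (2 * d)) {i j : ℕ}
    (h : i + 2 * j = 2 * d) :
    (X 0 ^ i * (X 1 * X 2) ^ j : MvPolynomial (Fin 3) k) ∈
      Algebra.adjoin k (basisForms (k := k) d ε) := by
  refine Algebra.subset_adjoin ((mem_basisForms hd hε).mpr (Or.inl ⟨j, by omega, ?_⟩))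
  rw [show 2 * d - 2 * j = i by omega, mono]
  ring

/-- The monomials of degree divisible by `2d` in `x₀`, `x₁x₂` and `x₁^d + x₂^d` are products of
such monomials of degree `2d`. -/
theorem secondary_mono_mem_adjoin [CharZero k] (hd : 1 ≤ d) (hε : IsPrimitiveRoot ε (2 * d))
    (l : ℕ) :
    ∀ i j c : ℕ, i + 2 * j + d * c = 2 * d * l →
      (X 0 ^ i * (X 1 * X 2) ^ j * (X 1 ^ d + X 2 ^ d) ^ c : MvPolynomial (Fin 3) k) ∈
        Algebra.adjoin k (basisForms (k := k) d ε) := by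
  induction l with
  | zero =>
    intro i j c h
    have hdc : d * c = 0 := by omega
    obtain rfl : c = 0 := (Nat.mul_eq_zero.mp hdc).resolve_left (by omega)
    obtain rfl : i = 0 := by omega
    obtain rfl : j = 0 := by omega
    simp
  | succ l ih =>
    intro i j c h
    rw [Nat.mul_succ] at h
    by_cases hc : 2 ≤ c
    -- The square `(x₁^d + x₂^d)² = (x₁^{2d} + x₂^{2d}) + 2 x₁^d x₂^d` has degree `2d` and is split
    -- off.
    · obtain ⟨c, rfl⟩ := Nat.exists_eq_add_of_le' hc
      rw [Nat.mul_add] at h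
      have h1 := ih i j c (by omega)
      have h2 : ((X 1 ^ d + X 2 ^ d) ^ 2 : MvPolynomial (Fin 3) k) ∈
          Algebra.adjoin k (basisForms (k := k) d ε) := by
        have h3 := Algebra.subset_adjoin (R := k) (X_one_pow_mul_mem_basisForms (k := k) hd hε)
        have h4 := Algebra.subset_adjoin (R := k) (X_one_pow_add_mem_basisForms (k := k) hd hε)
        convert add_mem h4 (add_mem h3 h3) using 1
        ring
      convert mul_mem h1 h2 using 1
      ring
    · by_cases h2d : 2 * d ≤ i + 2 * j
      -- Split off a factor `x₀^{i'} (x₁x₂)^{j'}` of degree exactly `2d`, taking `j' = min(j, d)`.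
      · have key : ∃ i' j', i' ≤ i ∧ j' ≤ j ∧ i' + 2 * j' = 2 * d := by
          by_cases hj : d ≤ j
          · exact ⟨0, d, by omega, hj, by omega⟩
          · exact ⟨2 * d - 2 * j, j, by omega, le_rfl, by omega⟩
        obtain ⟨i', j', hi, hj, hij⟩ := key
        obtain ⟨i, rfl⟩ := Nat.exists_eq_add_of_le hi
        obtain ⟨j, rfl⟩ := Nat.exists_eq_add_of_le hj
        convert mul_mem (X_zero_pow_mul_pow_mem_adjoin (k := k) hd hε hij)
          (ih i j c (by omega)) using 1
        ring
      -- Too little is left for such a factor, so the degree forces `c = 1` and `l = 0`: the product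
      -- is itself one binomial of degree `2d`.
      · have hc1 : c = 1 := by
          by_contra hc1
          obtain rfl : c = 0 := by omega
          omega
        subst hc1
        rw [show (X 0 ^ i * (X 1 * X 2) ^ j * (X 1 ^ d + X 2 ^ d) ^ 1 :
          MvPolynomial (Fin 3) k) = mono k i (j + d) j + mono k i j (j + d) by
            simp only [mono]; ring]
        have hl : l = 0 := by
          by_contra hl
          have : 2 * d * 1 ≤ 2 * d * l := Nat.mul_le_mul_left _ (by omega)
          omega
        subst hl
        exact symm_mono_mem_adjoin hd hε (by omega) (by simp)

/-- Newton's recurrence for `p_q = x₁^{dq} + x₂^{dq}`, namely `p_{q+2} = (x₁^d + x₂^d) p_{q+1} -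
(x₁x₂)^d p_q`. The free exponents `j` and `c` absorb the two coefficients. -/
theorem power_sum_mem_adjoin [CharZero k] (hd : 1 ≤ d) (hε : IsPrimitiveRoot ε (2 * d))
    (l q : ℕ) :
    ∀ i j c : ℕ, i + 2 * j + d * c + d * q = 2 * d * l →
      (X 0 ^ i * (X 1 * X 2) ^ j * (X 1 ^ d + X 2 ^ d) ^ c * (X 1 ^ (d * q) + X 2 ^ (d * q)) :
        MvPolynomial (Fin 3) k) ∈ Algebra.adjoin k (basisForms (k := k) d ε) := by
  induction q using Nat.twoStepInduction with
  | zero =>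
    intro i j c h
    have h1 := secondary_mono_mem_adjoin (k := k) hd hε l i j c (by omega)
    convert add_mem h1 h1 using 1
    rw [Nat.mul_zero, pow_zero, pow_zero]
    ring
  | one =>
    intro i j c h
    convert secondary_mono_mem_adjoin (k := k) hd hε l i j (c + 1) (by rw [Nat.mul_succ]; omega)
      using 1
    rw [Nat.mul_one]
    ring
  | more q ih0 ih1 =>
    intro i j c h
    rw [Nat.mul_succ, Nat.mul_succ] at h
    convert sub_mem (ih1 i j (c + 1) (by rw [Nat.mul_succ, Nat.mul_succ]; omega))
      (ih0 i (j + d) c (by omega)) using 1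
    ring

theorem symm_mono_mem_adjoin_of_degree [CharZero k] (hd : 1 ≤ d)
    (hε : IsPrimitiveRoot ε (2 * d)) {i j r l : ℕ} (hdeg : i + j + r = 2 * d * l)
    (hmod : (j : ZMod d) = r) :
    mono k i j r + mono k i r j ∈ Algebra.adjoin k (basisForms (k := k) d ε) := by
  wlog hrj : r ≤ j generalizing j r
  · rw [add_comm (mono k i j r)]
    exact this (j := r) (r := j) (by omega) hmod.symm (by omega)
  obtain ⟨q, hq⟩ : d ∣ j - r := (Nat.modEq_iff_dvd' hrj).mp
    ((ZMod.natCast_eq_natCast_iff _ _ _).mp hmod.symm)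
  obtain rfl : j = r + d * q := by omega
  -- Factoring out `(x₁x₂)^r` leaves the power sum `x₁^{dq} + x₂^{dq}`.
  convert power_sum_mem_adjoin (k := k) hd hε l q i r 0 (by omega) using 1
  simp only [mono]
  ring

/-- This identifies functions on the image with invariants, and is what makes the fibres of `φ`
single orbits. -/
theorem mem_adjoin_of_invariant [CharZero k] (hd : 1 ≤ d) (hε : IsPrimitiveRoot ε (2 * d))
    (ha : a ≤ d) (hda : Nat.gcd d a = 1) {p : MvPolynomial (Fin 3) k} {l : ℕ}
    (hp : p.IsHomogeneous (2 * d * l))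
    (hτ : act (diagMatrix (ε ^ 2) a (d - a)) p = p) (hη : act (swapMatrix k) p = p) :
    p ∈ Algebra.adjoin k (basisForms (k := k) d ε) := by
  rw [← Subalgebra.mem_toSubmodule]
  refine mem_of_swap_invariant _ hη fun m hm => ?_
  refine symm_mono_mem_adjoin_of_degree hd hε (l := l) ?_
    (natCast_eq_of_mem_support hε ha hda hτ hm)
  by_contra h
  refine (mem_support_iff.mp hm) (hp.coeff_eq_zero ?_)
  rwa [← expo_self m, expo_degree]

end InvariantRing

end

end GTSystem

namespace GTSystem

noncomputable section

/-! ### Constructing the morphism `[F_1 : ⋯ : F_r]` by gluing charts. -/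

section MorphismOfForms

open HomogeneousLocalization

attribute [local instance] MvPolynomial.gradedAlgebra

variable {k : Type u} [Field k] {m r N : ℕ} {F : Fin r → MvPolynomial (Fin m) k}

theorem aeval_isHomogeneous (hF : ∀ i, (F i).IsHomogeneous N) {P : MvPolynomial (Fin r) k}
    {e : ℕ} (hP : P ∈ homogeneousSubmodule (Fin r) k e) :
    aeval F P ∈ homogeneousSubmodule (Fin m) k (N * e) :=
  IsHomogeneous.aeval hP F hF

/-- The homomorphism `k[w]_{(P)} → k[x]_{(P(F))}` induced by `w_j ↦ F_j`. -/
theorem exists_awayHom (hF : ∀ i, (F i).IsHomogeneous N) (P : MvPolynomial (Fin r) k) :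
    ∃ θ : Away (homogeneousSubmodule (Fin r) k) P →+*
        Away (homogeneousSubmodule (Fin m) k) (aeval F P),
      ∀ z, (θ z).val = Localization.awayMap (aeval F).toRingHom P z.val := by
  let ι := algebraMap (Away (homogeneousSubmodule (Fin m) k) (aeval F P))
    (Localization.Away (aeval F P))
  let f := (Localization.awayMap (aeval F).toRingHom P).comp
    (algebraMap (Away (homogeneousSubmodule (Fin r) k) P) (Localization.Away P))
  -- Substituting forms of one degree `N` multiplies degrees by `N`, so degree-zero fractions stay
  -- of degree zero. As they embed in the full localization, the map can be restricted to them.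
  have hmem : ∀ z, f z ∈ ι.range := by
    intro z
    obtain ⟨⟨n, ⟨a, ha⟩, ⟨b, hb⟩, j, rfl : P ^ j = b⟩, rfl⟩ := mk_surjective z
    refine ⟨HomogeneousLocalization.mk ⟨N * n, ⟨aeval F a, aeval_isHomogeneous hF ha⟩,
      ⟨aeval F (P ^ j), aeval_isHomogeneous hF hb⟩, j, (map_pow _ _ _).symm⟩, ?_⟩
    simp only [ι, f, RingHom.comp_apply, HomogeneousLocalization.algebraMap_apply, val_mk,
      Localization.awayMap, IsLocalization.Away.map, Localization.mk_eq_mk', IsLocalization.map_mk']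
    rfl
  have hι : Function.Injective ι := val_injective _
  let e := RingEquiv.ofBijective ι.rangeRestrict
    ⟨fun x y h => hι (congrArg Subtype.val h), ι.rangeRestrict_surjective⟩
  refine ⟨e.symm.toRingHom.comp (f.codRestrict ι.range hmem), fun z => ?_⟩
  exact congrArg Subtype.val (e.apply_symm_apply ⟨f z, hmem z⟩)

/-- The homomorphism `k[w]_{(P)} → k[x]_{(P(F))}` induced by `w_j ↦ F_j`. -/
def awayHom (hF : ∀ i, (F i).IsHomogeneous N) (P : MvPolynomial (Fin r) k) :
    Away (homogeneousSubmodule (Fin r) k) P →+*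
      Away (homogeneousSubmodule (Fin m) k) (aeval F P) :=
  (exists_awayHom hF P).choose

theorem val_awayHom (hF : ∀ i, (F i).IsHomogeneous N) (P : MvPolynomial (Fin r) k)
    (z : Away (homogeneousSubmodule (Fin r) k) P) :
    (awayHom hF P z).val = Localization.awayMap (aeval F).toRingHom P z.val :=
  (exists_awayHom hF P).choose_spec z

theorem aeval_mem_smul (hF : ∀ i, (F i).IsHomogeneous N) {x : MvPolynomial (Fin r) k}
    {e n : ℕ} (hx : x ∈ homogeneousSubmodule (Fin r) k (n • e)) :
    aeval F x ∈ homogeneousSubmodule (Fin m) k (n • (N * e)) := by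
  have := aeval_isHomogeneous hF hx
  rwa [smul_eq_mul, mul_left_comm] at this

theorem awayHom_mk (hF : ∀ i, (F i).IsHomogeneous N) {P : MvPolynomial (Fin r) k} {e : ℕ}
    (hP : P ∈ homogeneousSubmodule (Fin r) k e) (n : ℕ) (x : MvPolynomial (Fin r) k)
    (hx : x ∈ homogeneousSubmodule (Fin r) k (n • e)) :
    awayHom hF P (Away.mk _ hP n x hx) =
      Away.mk _ (aeval_isHomogeneous hF hP) n (aeval F x) (aeval_mem_smul hF hx) := by
  refine val_injective _ ?_
  rw [val_awayHom, Away.val_mk, Away.val_mk]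
  simp only [Localization.awayMap, IsLocalization.Away.map, Localization.mk_eq_mk',
    IsLocalization.map_mk']
  congr 1
  exact Subtype.ext (map_pow _ _ _)

/-- Substitution commutes with restriction to a smaller basic open; this is the algebra behind the
gluing. -/
theorem awayMap_comp_awayHom (hF : ∀ i, (F i).IsHomogeneous N) {P Q T : MvPolynomial (Fin r) k}
    {e e' : ℕ} (hP : P ∈ homogeneousSubmodule (Fin r) k e)
    (hQ : Q ∈ homogeneousSubmodule (Fin r) k e') (hT : T = P * Q)
    (hT' : aeval F T = aeval F P * aeval F Q) :
    (awayMap (homogeneousSubmodule (Fin m) k) (aeval_isHomogeneous hF hQ) hT').comp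
        (awayHom hF P) =
      (awayHom hF T).comp (awayMap (homogeneousSubmodule (Fin r) k) hQ hT) := by
  ext z : 1
  obtain ⟨n, a, ha, rfl⟩ := Away.mk_surjective _ hP z
  rw [RingHom.comp_apply, RingHom.comp_apply, awayHom_mk, awayMap_mk, awayMap_mk, awayHom_mk]
  refine val_injective _ ?_
  rw [Away.val_mk, Away.val_mk]
  simp

theorem iSup_basicOpen_eq_top_of_forall {A σ : Type u} [CommRing A] [SetLike σ A]
    [AddSubgroupClass σ A] (𝒜 : ℕ → σ) [GradedRing 𝒜] {ι : Type*} {f : ι → A}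
    (h : ∀ y : Proj 𝒜, ∃ i, f i ∉ y.asHomogeneousIdeal) :
    ⨆ i, Proj.basicOpen 𝒜 (f i) = ⊤ := by
  refine top_le_iff.mp fun y _ => ?_
  obtain ⟨i, hi⟩ := h y
  exact TopologicalSpace.Opens.mem_iSup.mpr ⟨i, hi⟩

/-- The affine open cover by the sets `D₊(F_i)`. -/
def coverOfForms {A σ : Type u} [CommRing A] [SetLike σ A]
    [AddSubgroupClass σ A] (𝒜 : ℕ → σ) [GradedRing 𝒜] {ι : Type*} (f : ι → A) {d : ℕ}
    (hd : 0 < d) (hf : ∀ i, f i ∈ 𝒜 d) (h : ⨆ i, Proj.basicOpen 𝒜 (f i) = ⊤) :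
    (Proj 𝒜).AffineOpenCover where
  I₀ := ι
  X i := .of (Away 𝒜 (f i))
  f i := Proj.awayι 𝒜 (f i) (hf i) hd
  idx x := (TopologicalSpace.Opens.mem_iSup.mp (h.ge (Set.mem_univ x))).choose
  covers x := by
    change x ∈ (Proj.awayι 𝒜 _ _ _).opensRange
    rw [Proj.opensRange_awayι]
    exact (TopologicalSpace.Opens.mem_iSup.mp (h.ge (Set.mem_univ x))).choose_spec

theorem aeval_X_mem (hF : ∀ i, (F i).IsHomogeneous N) (i : Fin r) :
    aeval F (X i : MvPolynomial (Fin r) k) ∈ homogeneousSubmodule (Fin m) k N := by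
  rw [aeval_X]; exact hF i

/-- The morphism `[F_1 : ⋯ : F_r]` on the chart `D₊(F_i)`. -/
def formsChart (hF : ∀ i, (F i).IsHomogeneous N) (i : Fin r) :
    Spec (.of (Away (homogeneousSubmodule (Fin m) k)
      (aeval F (X i : MvPolynomial (Fin r) k)))) ⟶ projSpace k r :=
  Spec.map (CommRingCat.ofHom (awayHom hF (X i))) ≫
    Proj.awayι (homogeneousSubmodule (Fin r) k) (X i) (m := 1) (isHomogeneous_X k i) one_pos

/-- On the overlap `D₊(F_i F_j)` both charts are the substitution map `k[w]_{(w_i w_j)} → k[x]_{(F_i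
F_j)}`. -/
theorem formsChart_compat (hN : 0 < N) (hF : ∀ i, (F i).IsHomogeneous N) (i j : Fin r) :
    Limits.pullback.fst
        (Proj.awayι (homogeneousSubmodule (Fin m) k) _ (aeval_X_mem hF i) hN)
        (Proj.awayι (homogeneousSubmodule (Fin m) k) _ (aeval_X_mem hF j) hN) ≫ formsChart hF i =
      Limits.pullback.snd _ _ ≫ formsChart hF j := by
  have hij : aeval F (X i * X j : MvPolynomial (Fin r) k) =
      aeval F (X i : MvPolynomial (Fin r) k) * aeval F (X j : MvPolynomial (Fin r) k) :=
    map_mul _ _ _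
  have hX : ∀ i : Fin r, (X i : MvPolynomial (Fin r) k) ∈ homogeneousSubmodule (Fin r) k 1 :=
    isHomogeneous_X k
  have e1 := awayMap_comp_awayHom hF (hX i) (hX j) rfl hij
  have e2 := awayMap_comp_awayHom hF (hX j) (hX i)
    (mul_comm (X i : MvPolynomial (Fin r) k) (X j)) (hij.trans (mul_comm _ _))
  rw [← cancel_epi (Proj.pullbackAwayιIso (homogeneousSubmodule (Fin m) k)
      (aeval_X_mem hF i) hN (aeval_X_mem hF j) hN hij).inv, ← Category.assoc, ← Category.assoc,
    Proj.pullbackAwayιIso_inv_fst, Proj.pullbackAwayιIso_inv_snd, formsChart, formsChart,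
    ← Spec.map_comp_assoc, ← Spec.map_comp_assoc, ← CommRingCat.ofHom_comp,
    ← CommRingCat.ofHom_comp]
  have e1' := congrArg (fun t => Spec.map (CommRingCat.ofHom t) ≫
    Proj.awayι (homogeneousSubmodule (Fin r) k) (X i) (m := 1) (hX i) one_pos) e1
  have e2' := congrArg (fun t => Spec.map (CommRingCat.ofHom t) ≫
    Proj.awayι (homogeneousSubmodule (Fin r) k) (X j) (m := 1) (hX j) one_pos) e2
  refine e1'.trans (Eq.trans ?_ e2'.symm)
  simp only [CommRingCat.ofHom_comp, Spec.map_comp_assoc]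
  rw [Proj.SpecMap_awayMap_awayι, Proj.SpecMap_awayMap_awayι]

theorem exists_isMorphismOfForms (hN : 0 < N) (hF : ∀ i, (F i).IsHomogeneous N)
    (hcov : ⨆ i, Proj.basicOpen (homogeneousSubmodule (Fin m) k) (F i) = ⊤) :
    ∃ φ : projSpace k m ⟶ projSpace k r, IsMorphismOfForms hN F hF φ := by
  have hcov' : ⨆ i, Proj.basicOpen (homogeneousSubmodule (Fin m) k)
      (aeval F (X i : MvPolynomial (Fin r) k)) = ⊤ := by
    simpa only [aeval_X] using hcov
  let 𝒰 := (coverOfForms (homogeneousSubmodule (Fin m) k)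
    (fun i => aeval F (X i : MvPolynomial (Fin r) k)) hN (aeval_X_mem hF) hcov').openCover
  exact ⟨𝒰.glueMorphisms (formsChart hF) (formsChart_compat hN hF), hcov, fun i =>
    ⟨awayHom hF (X i), val_awayHom hF _,
      𝒰.ι_glueMorphisms (formsChart hF) (formsChart_compat hN hF) i⟩⟩

end MorphismOfForms

end

end GTSystem

namespace GTSystem

noncomputable section

/-! ### Preimages of basic opens, and finiteness of a morphism of forms. -/

section FiniteMorphism

open HomogeneousLocalization

attribute [local instance] MvPolynomial.gradedAlgebra

variable {k : Type u} [Field k] {m r N : ℕ} {F : Fin r → MvPolynomial (Fin m) k}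

theorem IsMorphismOfForms.awayι_comp {hN : 0 < N} {hF : ∀ i, (F i).IsHomogeneous N}
    {φ : projSpace k m ⟶ projSpace k r} (h : IsMorphismOfForms hN F hF φ) (i : Fin r) :
    Proj.awayι (homogeneousSubmodule (Fin m) k) _ (aeval_X_mem hF i) hN ≫ φ =
      formsChart hF i := by
  obtain ⟨θ, hθ, hφ⟩ := h.restrict i
  obtain rfl : θ = awayHom hF (X i) := by
    ext z : 1
    refine val_injective _ ?_
    rw [hθ, val_awayHom]
  exact hφ

theorem IsMorphismOfForms.exists_awayι {hN : 0 < N} {hF : ∀ i, (F i).IsHomogeneous N}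
    {φ : projSpace k m ⟶ projSpace k r} (h : IsMorphismOfForms hN F hF φ) (y : projSpace k m) :
    ∃ i q, Proj.awayι (homogeneousSubmodule (Fin m) k) _ (aeval_X_mem hF i) hN q = y := by
  obtain ⟨i, hi⟩ := TopologicalSpace.Opens.mem_iSup.mp (h.cover.ge (Set.mem_univ y))
  rw [← aeval_X (R := k) F i, ← Proj.opensRange_awayι _ _ (aeval_X_mem hF i) hN] at hi
  obtain ⟨q, hq⟩ := hi
  exact ⟨i, q, hq⟩

theorem IsMorphismOfForms.preimage_basicOpen {hN : 0 < N} {hF : ∀ i, (F i).IsHomogeneous N}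
    {φ : projSpace k m ⟶ projSpace k r} (h : IsMorphismOfForms hN F hF φ)
    {P : MvPolynomial (Fin r) k} {e : ℕ} (he : 0 < e)
    (hP : P ∈ homogeneousSubmodule (Fin r) k e) :
    φ ⁻¹ᵁ Proj.basicOpen (homogeneousSubmodule (Fin r) k) P =
      Proj.basicOpen (homogeneousSubmodule (Fin m) k) (aeval F P) := by
  have key : ∀ i, Proj.awayι (homogeneousSubmodule (Fin m) k) _ (aeval_X_mem hF i) hN ⁻¹ᵁ
      (φ ⁻¹ᵁ Proj.basicOpen (homogeneousSubmodule (Fin r) k) P) =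
      Proj.awayι (homogeneousSubmodule (Fin m) k) _ (aeval_X_mem hF i) hN ⁻¹ᵁ
      Proj.basicOpen (homogeneousSubmodule (Fin m) k) (aeval F P) := by
    intro i
    have hX : (X i : MvPolynomial (Fin r) k) ∈ homogeneousSubmodule (Fin r) k 1 :=
      isHomogeneous_X k i
    rw [← Scheme.Hom.comp_preimage, h.awayι_comp, formsChart, Scheme.Hom.comp_preimage,
      Proj.awayι_preimage_basicOpen _ hX one_pos hP he,
      Proj.awayι_preimage_basicOpen _ (aeval_X_mem hF i) hN (aeval_isHomogeneous hF hP)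
        (Nat.mul_pos hN he)]
    -- For `P` of degree `e`, the left side is `P(F)^N / F_i^{Ne}` and the element pulled back from
    -- the target is `P(F) / F_i^e`; they differ by an `N`-th power, which cuts out the same open
    -- set.
    have hpow : Away.isLocalizationElem (aeval_X_mem hF i) (aeval_isHomogeneous hF hP) =
        awayHom hF (X i) (Away.isLocalizationElem hX hP) ^ N := by
      rw [awayHom_mk]
      refine val_injective _ ?_
      rw [val_pow, Away.val_mk, Away.val_mk, Localization.mk_pow]
      congr 1
      · simp
      · refine Subtype.ext ?_
        simp only [SubmonoidClass.mk_pow, ← pow_mul]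
        rw [mul_comm]
    rw [hpow, PrimeSpectrum.basicOpen_pow _ _ hN]
    rfl
  ext y
  obtain ⟨i, q, rfl⟩ := h.exists_awayι y
  exact SetLike.ext_iff.mp (key i) q

theorem mem_zero_iff {n : ℕ} (c : homogeneousSubmodule (Fin n) k 0) :
    ∃ c' : k, c.1 = C c' := by
  refine ⟨coeff 0 c.1, ?_⟩
  rw [← homogeneousComponent_zero, homogeneousComponent_eq_self c.2]

/-- Degree-zero elements are constants, which already live on the target. Generators over the
constants are therefore generators over the target chart. -/
theorem algebraMap_zero_mem_range (hF : ∀ i, (F i).IsHomogeneous N) (P : MvPolynomial (Fin r) k)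
    (c : homogeneousSubmodule (Fin m) k 0) :
    algebraMap _ (Away (homogeneousSubmodule (Fin m) k) (aeval F P)) c ∈
      (awayHom hF P).range := by
  obtain ⟨c', hc'⟩ := mem_zero_iff c
  refine ⟨fromZeroRingHom _ _ ⟨C c', isHomogeneous_C _ _⟩, ?_⟩
  refine val_injective _ ?_
  rw [val_awayHom]
  change Localization.awayMap (aeval F).toRingHom P (Localization.mk (C c') 1) =
    Localization.mk c.1 1
  rw [hc', Localization.mk_one_eq_algebraMap, Localization.mk_one_eq_algebraMap]
  simp only [Localization.awayMap, IsLocalization.Away.map, IsLocalization.map_eq]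
  congr 1
  exact aeval_C _ _

theorem adjoin_zero_X : Algebra.adjoin (homogeneousSubmodule (Fin m) k 0)
    (Set.range (X : Fin m → MvPolynomial (Fin m) k)) = ⊤ := by
  refine top_le_iff.mp fun p _ => ?_
  induction p using MvPolynomial.induction_on with
  | C c => exact Subalgebra.algebraMap_mem _ (⟨C c, isHomogeneous_C _ _⟩ :
      homogeneousSubmodule (Fin m) k 0)
  | add p q hp hq => exact add_mem (hp trivial) (hq trivial)
  | mul_X p i hp => exact mul_mem (hp trivial) (Algebra.subset_adjoin ⟨i, rfl⟩)

instance finiteType_zero : Algebra.FiniteType (homogeneousSubmodule (Fin m) k 0)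
    (MvPolynomial (Fin m) k) := by
  refine ⟨Subalgebra.fg_def.mpr ⟨_, Set.finite_range X, adjoin_zero_X⟩⟩

theorem X_pow_mem (j : Fin m) (N : ℕ) :
    X j ^ N ∈ homogeneousSubmodule (Fin m) k (1 • N) := by
  rw [one_smul]
  exact isHomogeneous_X_pow j N

/-- If the fractions `x_j ^ N / F_i` are integral, then the morphism of forms is finite over
`D₊(w_i)`. -/
theorem finite_awayHom (hN : 0 < N) (hF : ∀ i, (F i).IsHomogeneous N) (i : Fin r)
    (H : ∀ j, (awayHom hF (X i)).IsIntegralElem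
      (Away.mk _ (aeval_X_mem hF i) 1 (X j ^ N) (X_pow_mem j N))) :
    (awayHom hF (X i)).Finite := by
  let := (awayHom hF (X i)).toAlgebra
  have hgen := Away.adjoin_mk_prod_pow_eq_top (𝒜 := homogeneousSubmodule (Fin m) k)
    (aeval_X_mem hF i) (Fin m) X adjoin_zero_X (fun _ => 1) (isHomogeneous_X k)
  have hint : Algebra.IsIntegral (Away (homogeneousSubmodule (Fin r) k) (X i))
      (Away (homogeneousSubmodule (Fin m) k) (aeval F (X i : MvPolynomial (Fin r) k))) := by
    refine ⟨fun b => ?_⟩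
    have hb : b ∈ Algebra.adjoin _ _ := hgen.ge (Algebra.mem_top : b ∈ ⊤)
    induction hb using Algebra.adjoin_induction with
    | mem b hb =>
      obtain ⟨a, ai, hai, -, rfl⟩ := hb
      refine IsIntegral.of_pow hN ?_
      -- The `N`-th power of `∏ x_j^{a_j} / F_i^a` is `∏ (x_j^N / F_i)^{a_j}`, because `∑ a_j = aN`.
      have : Away.mk (homogeneousSubmodule (Fin m) k) (aeval_X_mem hF i) a
          (∏ j, X j ^ ai j) (hai ▸ SetLike.prod_pow_mem_graded _ _ _ _ fun j _ =>
            isHomogeneous_X k j) ^ N =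
          ∏ j, (Away.mk _ (aeval_X_mem hF i) 1 (X j ^ N) (X_pow_mem j N)) ^ ai j := by
        refine val_injective _ ?_
        rw [← HomogeneousLocalization.algebraMap_apply, ← HomogeneousLocalization.algebraMap_apply,
          map_pow, map_prod]
        simp only [map_pow, HomogeneousLocalization.algebraMap_apply, Away.val_mk,
          Localization.mk_pow, Localization.mk_prod]
        congr 1
        · rw [← Finset.prod_pow]
          exact Finset.prod_congr rfl fun j _ => by rw [← pow_mul, ← pow_mul, mul_comm]
        · refine Subtype.ext ?_
          simp only [smul_eq_mul, mul_one] at hai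
          rw [SubmonoidClass.coe_pow, SubmonoidClass.coe_finsetProd]
          simp only [SubmonoidClass.coe_pow, pow_one]
          rw [Finset.prod_pow_eq_pow_sum, hai, pow_mul]
      rw [this]
      exact IsIntegral.prod _ fun j _ => IsIntegral.pow (H j) _
    | algebraMap c =>
      obtain ⟨c', hc'⟩ := algebraMap_zero_mem_range hF (X i) c
      rw [← hc']
      exact isIntegral_algebraMap
    | add b c _ _ hb hc => exact hb.add hc
    | mul b c _ _ hb hc => exact hb.mul hc
  have hft : Algebra.FiniteType (Away (homogeneousSubmodule (Fin r) k) (X i))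
      (Away (homogeneousSubmodule (Fin m) k) (aeval F (X i : MvPolynomial (Fin r) k))) := by
    obtain ⟨s, hs⟩ := (Away.finiteType (𝒜 := homogeneousSubmodule (Fin m) k) _ _
      (aeval_X_mem hF i)).out
    refine ⟨s, top_le_iff.mp fun b _ => ?_⟩
    have hb : b ∈ Algebra.adjoin _ _ := hs.ge (Algebra.mem_top : b ∈ ⊤)
    induction hb using Algebra.adjoin_induction with
    | mem b hb => exact Algebra.subset_adjoin hb
    | algebraMap c =>
      obtain ⟨c', hc'⟩ := algebraMap_zero_mem_range hF (X i) c
      rw [← hc']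
      exact Subalgebra.algebraMap_mem _ _
    | add b c _ _ hb hc => exact add_mem (hb trivial) (hc trivial)
    | mul b c _ _ hb hc => exact mul_mem (hb trivial) (hc trivial)
  exact Algebra.IsIntegral.finite

theorem iSup_basicOpen_X (r : ℕ) :
    ⨆ i, Proj.basicOpen (homogeneousSubmodule (Fin r) k) (X i) = ⊤ :=
  Proj.iSup_basicOpen_eq_top' _ _ (fun i => ⟨1, isHomogeneous_X k i⟩) adjoin_zero_X

theorem X_mem (i : Fin r) : (X i : MvPolynomial (Fin r) k) ∈ homogeneousSubmodule (Fin r) k 1 :=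
  isHomogeneous_X k i

theorem isZariskiLocalAtTarget_isFinite : IsZariskiLocalAtTarget (@IsFinite.{u}) :=
  @HasAffineProperty.instIsZariskiLocalAtTarget _ _
    IsFinite.instHasAffinePropertyAndIsAffineFiniteCarrierObjOppositeOpensCarrierCarrierCommRingCatPresheafOpOpensTopHomAppTop

/-- The preimage of `D₊(w_i)` is `D₊(F_i)`, so the base change of `φ` to this chart is `Spec` of the
substitution map. -/
theorem IsMorphismOfForms.isFinite_pullback_snd {hN : 0 < N} {hF : ∀ i, (F i).IsHomogeneous N}
    {φ : projSpace k m ⟶ projSpace k r} (h : IsMorphismOfForms hN F hF φ) (i : Fin r)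
    (H : ∀ j, (awayHom hF (X i)).IsIntegralElem
      (Away.mk _ (aeval_X_mem hF i) 1 (X j ^ N) (X_pow_mem j N))) :
    IsFinite (Limits.pullback.snd φ (Proj.awayι (homogeneousSubmodule (Fin r) k) (X i) (m := 1)
      (X_mem i) one_pos)) := by
  have hpb := IsOpenImmersion.isPullback (Spec.map (CommRingCat.ofHom (awayHom hF (X i))))
    (Proj.awayι (homogeneousSubmodule (Fin m) k) _ (aeval_X_mem hF i) hN)
    (Proj.awayι (homogeneousSubmodule (Fin r) k) (X i) (m := 1) (X_mem i) one_pos)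
    φ (h.awayι_comp i) (by
      rw [Proj.opensRange_awayι, Proj.opensRange_awayι]
      exact h.preimage_basicOpen one_pos (X_mem i))
  have hfin : IsFinite (Spec.map (CommRingCat.ofHom (awayHom hF (X i)))) :=
    (IsFinite.SpecMap_iff _).mpr (finite_awayHom hN hF i H)
  rw [← hpb.flip.isoPullback_inv_snd]
  infer_instance

theorem IsMorphismOfForms.isFinite {hN : 0 < N} {hF : ∀ i, (F i).IsHomogeneous N}
    {φ : projSpace k m ⟶ projSpace k r} (h : IsMorphismOfForms hN F hF φ)
    (H : ∀ i j, (awayHom hF (X i)).IsIntegralElem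
      (Away.mk _ (aeval_X_mem hF i) 1 (X j ^ N) (X_pow_mem j N))) : IsFinite φ := by
  let 𝒰 := (coverOfForms (homogeneousSubmodule (Fin r) k) X one_pos X_mem
    (iSup_basicOpen_X r)).openCover
  have := isZariskiLocalAtTarget_isFinite
  exact IsZariskiLocalAtTarget.of_openCover (P := @IsFinite) 𝒰 fun i =>
    h.isFinite_pullback_snd i (H i)

end FiniteMorphism

end

end GTSystem

namespace GTSystem

noncomputable section

/-! ### The basis forms define a finite morphism on the whole plane. -/

section DihedralMorphism

open HomogeneousLocalization

attribute [local instance] MvPolynomial.gradedAlgebra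

variable {k : Type u} [Field k] {d r : ℕ} [NeZero d] {ε : kˣ} {F : Fin r → MvPolynomial (Fin 3) k}

/-- Written as numerator times a power of the inverse of `f`, equalities of degree-zero fractions
become ring identities. -/
theorem val_mk_eq_mul {A σ ι : Type*} [CommRing A] [SetLike σ A] [AddSubgroupClass σ A]
    [AddCommMonoid ι] [DecidableEq ι] {𝒜 : ι → σ} [GradedRing 𝒜] {f : A} {e : ι}
    (hf : f ∈ 𝒜 e) (n : ℕ) (x : A) (hx : x ∈ 𝒜 (n • e)) :
    (Away.mk 𝒜 hf n x hx).val =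
      algebraMap A (Localization.Away f) x * IsLocalization.Away.invSelf f ^ n := by
  rw [Away.val_mk, Localization.mk_eq_mk', IsLocalization.mk'_eq_mul_mk'_one,
    IsLocalization.Away.invSelf, ← IsLocalization.mk'_pow, one_pow]
  rfl

theorem mk_mem_range_awayHom {m N : ℕ} {F : Fin r → MvPolynomial (Fin m) k}
    (hF : ∀ i, (F i).IsHomogeneous N) (i l : Fin r)
    (hl : F l ∈ homogeneousSubmodule (Fin m) k (1 • N)) :
    Away.mk _ (aeval_X_mem hF i) 1 (F l) hl ∈ (awayHom hF (X i)).range := by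
  refine ⟨Away.mk _ (X_mem i) 1 (X l) (X_mem l), ?_⟩
  rw [awayHom_mk]
  refine val_injective _ ?_
  rw [val_mk_eq_mul, val_mk_eq_mul, aeval_X F l]

theorem isIntegralElem_of_range {A B : Type*} [CommRing A] [CommRing B] (f : A →+* B) {x b c : B}
    (hb : b ∈ f.range) (hc : c ∈ f.range) (h : x ^ 2 - b * x + c ^ 2 = 0) :
    f.IsIntegralElem x := by
  obtain ⟨b, rfl⟩ := hb
  obtain ⟨c, rfl⟩ := hc
  refine ⟨Polynomial.X ^ 2 + (Polynomial.C (-b) * Polynomial.X + Polynomial.C (c ^ 2)), ?_, ?_⟩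
  · refine Polynomial.monic_X_pow_add (lt_of_le_of_lt Polynomial.degree_linear_le ?_)
    norm_num
  · simp only [Polynomial.eval₂_add, Polynomial.eval₂_pow, Polynomial.eval₂_X,
      Polynomial.eval₂_mul, Polynomial.eval₂_C, Polynomial.eval₂_neg, map_neg, map_pow]
    linear_combination h

/-- `x₁^{2d}` and `x₂^{2d}` are the roots of `T² - (x₁^{2d} + x₂^{2d}) T + (x₁^d x₂^d)²`, whose
coefficients come from basis forms; `x₀^{2d}` is itself a basis form. -/
theorem isIntegralElem_X_pow (hd : 1 ≤ d) (hε : IsPrimitiveRoot ε (2 * d))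
    (hF : ∀ i, (F i).IsHomogeneous (2 * d)) (hB : Set.range F = basisForms d ε)
    (i : Fin r) (j : Fin 3) : (awayHom hF (X i)).IsIntegralElem
      (Away.mk _ (aeval_X_mem hF i) 1 (X j ^ (2 * d)) (X_pow_mem j (2 * d))) := by
  obtain ⟨l₀, h0⟩ := hB.ge (X_zero_pow_mem_basisForms hd hε)
  obtain ⟨l₁, h1⟩ := hB.ge (X_one_pow_mul_mem_basisForms hd hε)
  obtain ⟨l₂, h2⟩ := hB.ge (X_one_pow_add_mem_basisForms hd hε)
  have hmem : ∀ l, F l ∈ homogeneousSubmodule (Fin 3) k (1 • (2 * d)) := fun l => by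
    rw [one_smul]
    exact hF l
  have key : ∀ j : Fin 3, j = 1 ∨ j = 2 → (awayHom hF (X i)).IsIntegralElem
      (Away.mk _ (aeval_X_mem hF i) 1 (X j ^ (2 * d)) (X_pow_mem j (2 * d))) := by
    intro j hj
    refine isIntegralElem_of_range _ (mk_mem_range_awayHom hF i l₂ (hmem l₂))
      (mk_mem_range_awayHom hF i l₁ (hmem l₁)) ?_
    refine val_injective _ ?_
    simp only [← HomogeneousLocalization.algebraMap_apply, map_add, map_sub, map_mul, map_pow,
      map_zero]
    simp only [HomogeneousLocalization.algebraMap_apply, val_mk_eq_mul, h1, h2, map_add, map_mul,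
      map_pow]
    rcases hj with rfl | rfl <;> ring
  by_cases hj : j = 0
  · subst hj
    obtain ⟨z, hz⟩ := mk_mem_range_awayHom hF i l₀ (hmem l₀)
    have : Away.mk _ (aeval_X_mem hF i) 1 (X 0 ^ (2 * d)) (X_pow_mem 0 (2 * d)) =
        awayHom hF (X i) z := by
      rw [hz]
      refine val_injective _ ?_
      rw [val_mk_eq_mul, val_mk_eq_mul, h0]
    rw [this]
    exact RingHom.isIntegralElem_map _
  · exact key j (by fin_cases j <;> simp_all)

/-- A prime containing `x₀^{2d}`, `x₁^d x₂^d` and `x₁^{2d} + x₂^{2d}` contains all three variables.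
-/
theorem iSup_basicOpen_eq_top (hd : 1 ≤ d) (hε : IsPrimitiveRoot ε (2 * d))
    (hB : Set.range F = basisForms d ε) :
    ⨆ i, Proj.basicOpen (homogeneousSubmodule (Fin 3) k) (F i) = ⊤ := by
  refine iSup_basicOpen_eq_top_of_forall _ fun y => ?_
  by_contra! h
  have hmem : ∀ f ∈ basisForms d ε, f ∈ y.asHomogeneousIdeal.toIdeal := by
    rw [← hB]
    rintro _ ⟨i, rfl⟩
    exact h i
  have hp : y.asHomogeneousIdeal.toIdeal.IsPrime := y.isPrime
  have h0 := hp.mem_of_pow_mem _ (hmem _ (X_zero_pow_mem_basisForms hd hε))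
  have h1 := hmem _ (X_one_pow_mul_mem_basisForms hd hε)
  have h2 := hmem _ (X_one_pow_add_mem_basisForms hd hε)
  have h12 : X 1 ∈ y.asHomogeneousIdeal.toIdeal ∧ X 2 ∈ y.asHomogeneousIdeal.toIdeal := by
    rcases hp.mem_or_mem h1 with h | h
    · have h := hp.mem_of_pow_mem _ h
      refine ⟨h, hp.mem_of_pow_mem (2 * d) ?_⟩
      exact (Ideal.add_mem_iff_right _ (Ideal.pow_mem_of_mem _ h _ (by omega))).mp h2
    · have h := hp.mem_of_pow_mem _ h
      refine ⟨hp.mem_of_pow_mem (2 * d) ?_, h⟩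
      exact (Ideal.add_mem_iff_left _ (Ideal.pow_mem_of_mem _ h _ (by omega))).mp h2
  obtain ⟨i, hi⟩ := TopologicalSpace.Opens.mem_iSup.mp
    ((iSup_basicOpen_X (k := k) 3).ge (Set.mem_univ y))
  fin_cases i
  · exact hi h0
  · exact hi h12.1
  · exact hi h12.2

end DihedralMorphism

end

end GTSystem

namespace GTSystem

noncomputable section

/-! ### Projective transformations induced by linear substitutions. -/

section ProjectiveTransformation

open HomogeneousLocalization HomogeneousIdeal

attribute [local instance] MvPolynomial.gradedAlgebra

variable {k : Type u} [Field k] {r N : ℕ} {F : Fin r → MvPolynomial (Fin 3) k}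

theorem act_mem (g : GL (Fin 3) k) {p : MvPolynomial (Fin 3) k} {n : ℕ}
    (hp : p ∈ homogeneousSubmodule (Fin 3) k n) : act g p ∈ homogeneousSubmodule (Fin 3) k n :=
  IsHomogeneous.act hp g

/-- A linear substitution as a homomorphism of graded rings. -/
def actGraded (g : GL (Fin 3) k) :
    homogeneousSubmodule (Fin 3) k →+*ᵍ homogeneousSubmodule (Fin 3) k where
  __ := (act g).toRingHom
  map_mem hx := act_mem g hx

theorem actGraded_apply (g : GL (Fin 3) k) (p : MvPolynomial (Fin 3) k) :
    actGraded g p = act g p := rfl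

theorem actGraded_one : actGraded (1 : GL (Fin 3) k) = .id _ := by
  ext p : 1
  exact act_one_apply p

theorem actGraded_mul (g h : GL (Fin 3) k) :
    actGraded (g * h) = (actGraded g).comp (actGraded h) := by
  ext p : 1
  exact act_mul_apply g h p

theorem irrelevant_le_map_actGraded (g : GL (Fin 3) k) :
    irrelevant (homogeneousSubmodule (Fin 3) k) ≤
      (irrelevant (homogeneousSubmodule (Fin 3) k)).map (actGraded g) := by
  refine (irrelevant_le _).mpr fun i hi p hp => ?_
  have : p = actGraded g (act g⁻¹ p) := by
    rw [actGraded_apply, ← act_mul_apply, mul_inv_cancel, act_one_apply]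
  rw [this]
  exact Ideal.mem_map_of_mem _ (mem_irrelevant_of_mem _ hi (act_mem g⁻¹ hp))

/-- The projective transformation given by a linear substitution. -/
def projAct (g : GL (Fin 3) k) : projSpace k 3 ⟶ projSpace k 3 :=
  Proj.map (actGraded g) (irrelevant_le_map_actGraded g)

theorem projAct_one : projAct (1 : GL (Fin 3) k) = 𝟙 _ := by
  rw [← Proj.map_id]
  simp only [projAct, actGraded_one]

theorem projAct_mul (g h : GL (Fin 3) k) : projAct (g * h) = projAct g ≫ projAct h := by
  rw [projAct, projAct, projAct, ← Proj.map_comp]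
  simp only [actGraded_mul]

/-- Keeping `act g s = t` as an equation lets `t` be `s` itself when `s` is invariant, so that
source and target are the same chart. -/
theorem exists_awayι_comp_projAct (g : GL (Fin 3) k) {s t : MvPolynomial (Fin 3) k} {e : ℕ}
    (he : 0 < e) (hs : s ∈ homogeneousSubmodule (Fin 3) k e)
    (ht : t ∈ homogeneousSubmodule (Fin 3) k e) (hst : act g s = t) :
    ∃ θ : Away (homogeneousSubmodule (Fin 3) k) s →+* Away (homogeneousSubmodule (Fin 3) k) t,
      Proj.awayι (homogeneousSubmodule (Fin 3) k) t ht he ≫ projAct g =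
        Spec.map (CommRingCat.ofHom θ) ≫ Proj.awayι (homogeneousSubmodule (Fin 3) k) s hs he ∧
      ∀ n x hx, θ (Away.mk _ hs n x hx) = Away.mk _ ht n (act g x) (act_mem g hx) := by
  replace hst : actGraded g s = t := hst
  subst hst
  refine ⟨Away.map (actGraded g) s, ?_, fun n x hx => ?_⟩
  · exact Proj.awayι_comp_map _ (irrelevant_le_map_actGraded g) he s hs
  · exact Away.map_mk (actGraded g) s hs n x hx

theorem aeval_mem_smul_one {m : ℕ} {F : Fin r → MvPolynomial (Fin m) k}
    (hF : ∀ i, (F i).IsHomogeneous N) {x : MvPolynomial (Fin r) k} {n : ℕ}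
    (hx : x ∈ homogeneousSubmodule (Fin r) k (n • 1)) :
    aeval F x ∈ homogeneousSubmodule (Fin m) k (n • N) :=
  (mul_one N ▸ aeval_mem_smul hF hx :)

theorem awayHom_X_mk {m : ℕ} {F : Fin r → MvPolynomial (Fin m) k}
    (hF : ∀ i, (F i).IsHomogeneous N) (i : Fin r) (n : ℕ) (x : MvPolynomial (Fin r) k)
    (hx : x ∈ homogeneousSubmodule (Fin r) k (n • 1)) :
    awayHom hF (X i) (Away.mk _ (X_mem i) n x hx) =
      Away.mk _ (aeval_X_mem hF i) n (aeval F x) (aeval_mem_smul_one hF hx) := by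
  rw [awayHom_mk]
  refine val_injective _ ?_
  rw [val_mk_eq_mul, val_mk_eq_mul]

theorem IsMorphismOfForms.projAct_comp {hN : 0 < N} {hF : ∀ i, (F i).IsHomogeneous N}
    {φ : projSpace k 3 ⟶ projSpace k r} (h : IsMorphismOfForms hN F hF φ) (g : GL (Fin 3) k)
    (hg : ∀ i, act g (F i) = F i) : projAct g ≫ φ = φ := by
  have hcomp : (act g).comp (aeval F) = aeval F := by
    ext i
    rw [AlgHom.comp_apply, aeval_X, hg]
  have hinv : ∀ p, act g (aeval F p) = aeval F p := fun p => DFunLike.congr_fun hcomp p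
  have hcov : ⨆ i, Proj.basicOpen (homogeneousSubmodule (Fin 3) k)
      (aeval F (X i : MvPolynomial (Fin r) k)) = ⊤ := by
    simpa only [aeval_X] using h.cover
  let 𝒰 := (coverOfForms (homogeneousSubmodule (Fin 3) k)
    (fun i => aeval F (X i : MvPolynomial (Fin r) k)) hN (aeval_X_mem hF) hcov).openCover
  have key : ∀ i : Fin r,
      Proj.awayι (homogeneousSubmodule (Fin 3) k) _ (aeval_X_mem hF i) hN ≫ projAct g ≫ φ =
      Proj.awayι (homogeneousSubmodule (Fin 3) k) _ (aeval_X_mem hF i) hN ≫ φ := by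
    intro i
    obtain ⟨θ, hθ, hθ'⟩ := exists_awayι_comp_projAct g hN (aeval_X_mem hF i) (aeval_X_mem hF i)
      (hinv _)
    have hθF : θ.comp (awayHom hF (X i)) = awayHom hF (X i) := by
      ext z : 1
      obtain ⟨n, x, hx, rfl⟩ := Away.mk_surjective _ (X_mem i) z
      rw [RingHom.comp_apply, awayHom_X_mk, hθ']
      refine val_injective _ ?_
      rw [val_mk_eq_mul, val_mk_eq_mul, hinv]
    rw [← Category.assoc, hθ, Category.assoc, h.awayι_comp, formsChart, ← Spec.map_comp_assoc,
      ← CommRingCat.ofHom_comp, hθF]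
  exact 𝒰.hom_ext _ _ key

end ProjectiveTransformation

end

end GTSystem

namespace GTSystem

noncomputable section

/-! ### Root extraction in domains, and endomorphisms over `φ` restricted to charts. -/

section Chart

open HomogeneousLocalization

attribute [local instance] MvPolynomial.gradedAlgebra

theorem pow_eq_or_of_mul_eq_of_add_eq {A : Type*} [CommRing A] [IsDomain A] {x y x' y' : A}
    (hmul : x' * y' = x * y) (hadd : x' + y' = x + y) : x' = x ∨ x' = y := by
  have : (x' - x) * (x' - y) = 0 := by linear_combination x' * hadd - hmul
  rcases mul_eq_zero.mp this with h | h
  · exact Or.inl (sub_eq_zero.mp h)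
  · exact Or.inr (sub_eq_zero.mp h)

theorem exists_eq_pow_mul {A : Type*} [CommRing A] [IsDomain A] {ζ : A} {d : ℕ} (hd : 0 < d)
    (hζ : IsPrimitiveRoot ζ d) {x y : A} (h : x ^ d = y ^ d) : ∃ i < d, x = ζ ^ i * y := by
  have h0 : ∏ z ∈ Polynomial.nthRootsFinset d (1 : A), (x - z * y) = 0 := by
    rw [← hζ.pow_sub_pow_eq_prod_sub_mul x y hd, h, sub_self]
  obtain ⟨z, hz, hz0⟩ := Finset.prod_eq_zero_iff.mp h0
  have : NeZero d := ⟨hd.ne'⟩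
  obtain ⟨i, hi, rfl⟩ := hζ.eq_pow_of_pow_eq_one
    ((Polynomial.mem_nthRootsFinset hd 1).mp hz)
  exact ⟨i, hi, sub_eq_zero.mp hz0⟩

/-- The pairs of `d`-th powers have equal sum and product, so `x'^d` is `x^d` or `y^d` and `x'` is a
root of unity times `x` or `y`. Cancelling in `x'y' = xy` then determines `y'`. The two cases are
the rotations and the reflections. -/
theorem exists_dihedral_of_mul_eq_of_pow_add_eq {A : Type*} [CommRing A] [IsDomain A] {ζ : A}
    {d : ℕ} (hd : 0 < d) (hζ : IsPrimitiveRoot ζ d) {x y x' y' : A} (hx : x ≠ 0) (hy : y ≠ 0)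
    (hmul : x' * y' = x * y) (hadd : x' ^ d + y' ^ d = x ^ d + y ^ d) :
    ∃ i < d, x' = ζ ^ i * x ∧ ζ ^ i * y' = y ∨ x' = ζ ^ i * y ∧ ζ ^ i * y' = x := by
  rcases pow_eq_or_of_mul_eq_of_add_eq (by rw [← mul_pow, hmul, mul_pow]) hadd with h | h
  · obtain ⟨i, hi, rfl⟩ := exists_eq_pow_mul hd hζ h
    refine ⟨i, hi, Or.inl ⟨rfl, mul_left_cancel₀ hx ?_⟩⟩
    linear_combination hmul
  · obtain ⟨i, hi, rfl⟩ := exists_eq_pow_mul hd hζ h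
    refine ⟨i, hi, Or.inr ⟨rfl, mul_left_cancel₀ hy ?_⟩⟩
    linear_combination hmul

variable {k : Type u} [Field k] {d a r N m : ℕ}

theorem isDomain_away {s : MvPolynomial (Fin m) k} (hs : s ≠ 0) :
    IsDomain (Away (homogeneousSubmodule (Fin m) k) s) := by
  have : IsDomain (Localization.Away s) :=
    IsLocalization.isDomain_localization (powers_le_nonZeroDivisors_of_noZeroDivisors hs)
  exact Function.Injective.isDomain
    (algebraMap (Away (homogeneousSubmodule (Fin m) k) s) (Localization.Away s)) (val_injective _)

theorem mk_one_injective {s : MvPolynomial (Fin m) k} (hs0 : s ≠ 0)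
    (hs : s ∈ homogeneousSubmodule (Fin m) k N) {p q : MvPolynomial (Fin m) k}
    {hp : p ∈ homogeneousSubmodule (Fin m) k (1 • N)}
    {hq : q ∈ homogeneousSubmodule (Fin m) k (1 • N)}
    (h : Away.mk _ hs 1 p hp = Away.mk _ hs 1 q hq) : p = q := by
  have hu : IsUnit (IsLocalization.Away.invSelf (S := Localization.Away s) s) :=
    IsUnit.of_mul_eq_one _ ((mul_comm _ _).trans (IsLocalization.Away.mul_invSelf s))
  have h' := congrArg val h
  rw [val_mk_eq_mul, val_mk_eq_mul] at h'
  exact IsLocalization.injective _ (powers_le_nonZeroDivisors_of_noZeroDivisors hs0)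
    ((hu.pow 1).mul_right_cancel h')

/-- Reducedness allows two morphisms that agree on a dense chart to be identified. -/
instance isReduced_projSpace : IsReduced (projSpace k m) := by
  let 𝒰 := (coverOfForms (homogeneousSubmodule (Fin m) k) X one_pos X_mem
    (iSup_basicOpen_X m)).openCover
  have (i : Fin m) : IsReduced (Spec (.of (Away (homogeneousSubmodule (Fin m) k) (X i)))) := by
    have := isDomain_away (k := k) (X_ne_zero i)
    infer_instance
  exact @IsReduced.of_openCover _ 𝒰 this

theorem exists_mem_basicOpen_of_mem {s : MvPolynomial (Fin m) k} (hs : s ≠ 0)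
    (U : (projSpace k m).Opens) {y : projSpace k m} (hy : y ∈ U) :
    ∃ z ∈ U, z ∈ Proj.basicOpen (homogeneousSubmodule (Fin m) k) s := by
  let η : ProjectiveSpectrum (homogeneousSubmodule (Fin m) k) :=
    { asHomogeneousIdeal := ⊥
      isPrime := Ideal.isPrime_bot
      -- The irrelevant ideal is nonzero because it is not contained in the ideal of `y`; the zero
      -- ideal is therefore a point, the generic one.
      not_irrelevant_le := fun h => y.not_irrelevant_le (h.trans bot_le) }
  have hle : η ≤ (y : ProjectiveSpectrum (homogeneousSubmodule (Fin m) k)) :=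
    (ProjectiveSpectrum.as_ideal_le_as_ideal _ _ _).mp bot_le
  have hη := specializes_iff_mem_closure.mpr ((ProjectiveSpectrum.le_iff_mem_closure _ _ _).mp hle)
  exact ⟨η, hη.mem_open U.isOpen hy, hs⟩

theorem isDominant_awayι {s : MvPolynomial (Fin m) k} (hs0 : s ≠ 0) {e : ℕ} (he : 0 < e)
    (hs : s ∈ homogeneousSubmodule (Fin m) k e) :
    IsDominant (Proj.awayι (homogeneousSubmodule (Fin m) k) s hs he) := by
  refine ⟨dense_iff_inter_open.mpr fun U hU ⟨y, hy⟩ => ?_⟩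
  obtain ⟨z, hzU, hz⟩ := exists_mem_basicOpen_of_mem hs0 ⟨U, hU⟩ hy
  rw [← Proj.opensRange_awayι _ _ hs he] at hz
  exact ⟨z, hzU, hz⟩

variable {F : Fin r → MvPolynomial (Fin m) k} {hN : 0 < N} {hF : ∀ i, (F i).IsHomogeneous N}
  {φ : projSpace k m ⟶ projSpace k r}

theorem IsMorphismOfForms.comp_awayHom (h : IsMorphismOfForms hN F hF φ)
    {ψ : projSpace k m ⟶ projSpace k m} (hψ : ψ ≫ φ = φ) (i : Fin r)
    {σ : Away (homogeneousSubmodule (Fin m) k) (aeval F (X i : MvPolynomial (Fin r) k)) →+*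
      Away (homogeneousSubmodule (Fin m) k) (aeval F (X i : MvPolynomial (Fin r) k))}
    (hσ : Proj.awayι (homogeneousSubmodule (Fin m) k) _ (aeval_X_mem hF i) hN ≫ ψ =
      Spec.map (CommRingCat.ofHom σ) ≫
        Proj.awayι (homogeneousSubmodule (Fin m) k) _ (aeval_X_mem hF i) hN) :
    σ.comp (awayHom hF (X i)) = awayHom hF (X i) := by
  have h1 := congrArg (· ≫ φ) hσ
  simp only [Category.assoc, hψ, h.awayι_comp, formsChart] at h1
  rw [← Spec.map_comp_assoc, ← CommRingCat.ofHom_comp] at h1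
  have h2 := (cancel_mono (Proj.awayι (homogeneousSubmodule (Fin r) k) (X i) (m := 1) (X_mem i)
    one_pos)).mp h1
  exact (congrArg CommRingCat.Hom.hom (Spec.map_injective h2)).symm

/-- `D₊(F_i)` is the preimage of `D₊(w_i)`, so an endomorphism over `φ` maps it to itself and is
given there by a ring homomorphism. -/
theorem IsMorphismOfForms.exists_chart (h : IsMorphismOfForms hN F hF φ)
    {ψ : projSpace k m ⟶ projSpace k m} (hψ : ψ ≫ φ = φ) (i : Fin r) :
    ∃ σ : Away (homogeneousSubmodule (Fin m) k) (aeval F (X i : MvPolynomial (Fin r) k)) →+*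
      Away (homogeneousSubmodule (Fin m) k) (aeval F (X i : MvPolynomial (Fin r) k)),
      Proj.awayι (homogeneousSubmodule (Fin m) k) _ (aeval_X_mem hF i) hN ≫ ψ =
        Spec.map (CommRingCat.ofHom σ) ≫
          Proj.awayι (homogeneousSubmodule (Fin m) k) _ (aeval_X_mem hF i) hN := by
  have hpre := h.preimage_basicOpen one_pos (X_mem i)
  have hrange : Set.range (Proj.awayι (homogeneousSubmodule (Fin m) k) _ (aeval_X_mem hF i) hN ≫
      ψ) ⊆ Set.range (Proj.awayι (homogeneousSubmodule (Fin m) k) _ (aeval_X_mem hF i) hN) := by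
    rintro _ ⟨q, rfl⟩
    have hq : Proj.awayι (homogeneousSubmodule (Fin m) k) _ (aeval_X_mem hF i) hN q ∈
        Proj.basicOpen (homogeneousSubmodule (Fin m) k)
          (aeval F (X i : MvPolynomial (Fin r) k)) := by
      rw [← Proj.opensRange_awayι _ _ (aeval_X_mem hF i) hN]
      exact ⟨q, rfl⟩
    change _ ∈ (Proj.awayι (homogeneousSubmodule (Fin m) k) _ (aeval_X_mem hF i) hN).opensRange
    rw [← hpre, ← hψ] at hq
    rw [Proj.opensRange_awayι, ← hpre]
    exact hq
  refine ⟨(Spec.preimage (IsOpenImmersion.lift _ _ hrange)).hom, ?_⟩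
  rw [CommRingCat.ofHom_hom, Spec.map_preimage, IsOpenImmersion.lift_fac]

end Chart

end

end GTSystem

namespace GTSystem

noncomputable section

/-! ### Faithfulness of the dihedral action, and the chart `x₀ ≠ 0`. -/

section DeckTransformations

open HomogeneousLocalization

attribute [local instance] MvPolynomial.gradedAlgebra

variable {k : Type u} [Field k] {d a r N : ℕ}

theorem act_diagMatrix_pow_mono (e : kˣ) (a b n i j l : ℕ) :
    act (diagMatrix e a b ^ n) (mono k i j l) =
      C (((e : k) ^ (a * j + b * l)) ^ n) * mono k i j l := by
  induction n with
  | zero => rw [pow_zero, pow_zero, act_one_apply, C_1, one_mul]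
  | succ n ih =>
    rw [pow_succ, act_mul_apply, act_diagMatrix_mono, map_mul, ih, algHom_C, algebraMap_eq,
      pow_succ, C_mul]
    ring

theorem act_dihedralRep_r_mono [NeZero d] {ε : kˣ} (hε : IsPrimitiveRoot ε (2 * d)) (ha : a ≤ d)
    (n : ZMod d) (i j l : ℕ) :
    act (dihedralRep d a ε hε ha (.r n)) (mono k i j l) =
      C ((((ε ^ 2 : kˣ) : k) ^ (a * j + (d - a) * l)) ^ n.val) * mono k i j l := by
  rw [dihedralRep_r, act_diagMatrix_pow_mono]

theorem act_dihedralRep_sr_mono [NeZero d] {ε : kˣ} (hε : IsPrimitiveRoot ε (2 * d)) (ha : a ≤ d)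
    (n : ZMod d) (i j l : ℕ) :
    act (dihedralRep d a ε hε ha (.sr n)) (mono k i j l) =
      C ((((ε ^ 2 : kˣ) : k) ^ (a * j + (d - a) * l)) ^ n.val) * mono k i l j := by
  rw [dihedralRep_sr, act_mul_apply, act_diagMatrix_pow_mono, map_mul, act_swapMatrix_mono,
    algHom_C, algebraMap_eq]

theorem isPrimitiveRoot_pow {ε : kˣ} (hd : 1 ≤ d) (hε : IsPrimitiveRoot ε (2 * d))
    (hda : Nat.gcd d a = 1) : IsPrimitiveRoot (((ε ^ 2 : kˣ) : k) ^ a) d := by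
  have he : IsPrimitiveRoot ((ε ^ 2 : kˣ) : k) d :=
    IsPrimitiveRoot.coe_units_iff.mpr (hε.pow (by omega) rfl)
  exact he.pow_of_coprime a (Nat.Coprime.symm hda)

theorem X_zero_pow_mem (d : ℕ) : (X 0 ^ (2 * d) : MvPolynomial (Fin 3) k) ∈
    homogeneousSubmodule (Fin 3) k (2 * d) := isHomogeneous_X_pow _ _

theorem act_X_zero_pow [NeZero d] {ε : kˣ} (hε : IsPrimitiveRoot ε (2 * d)) (ha : a ≤ d)
    (g : DihedralGroup d) (n : ℕ) : act (dihedralRep d a ε hε ha g) (X 0 ^ n) = X 0 ^ n := by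
  have : (X 0 ^ n : MvPolynomial (Fin 3) k) = mono k n 0 0 := by simp [mono]
  rw [this]
  rcases g with i | i
  · rw [act_dihedralRep_r_mono]; simp
  · rw [act_dihedralRep_sr_mono]; simp

theorem mono_mem {i j l n N : ℕ} (h : i + j + l = n * N) :
    mono k i j l ∈ homogeneousSubmodule (Fin 3) k (n • N) := isHomogeneous_mono h

/-- The fraction `x₁/x₀`, written `x₀^{2d-1} x₁ / x₀^{2d}`, detects everything: rotations multiply
it by powers of a primitive `d`-th root of unity, and reflections send it to a multiple of `x₂/x₀`.
-/
theorem eq_one_of_projAct_eq_id [NeZero d] {ε : kˣ} (hε : IsPrimitiveRoot ε (2 * d)) (ha : a ≤ d)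
    (hda : Nat.gcd d a = 1) {g : DihedralGroup d}
    (hg : projAct (dihedralRep d a ε hε ha g) = 𝟙 _) : g = 1 := by
  have hd : 1 ≤ d := NeZero.pos d
  obtain ⟨θ, hθ, hθ'⟩ := exists_awayι_comp_projAct (dihedralRep d a ε hε ha g)
    (Nat.mul_pos two_pos hd) (X_zero_pow_mem d) (X_zero_pow_mem d) (act_X_zero_pow hε ha g (2 * d))
  rw [hg, Category.comp_id] at hθ
  have h1 : Spec.map (CommRingCat.ofHom θ) = 𝟙 _ := by
    rw [← cancel_mono (Proj.awayι _ _ (X_zero_pow_mem d) (Nat.mul_pos two_pos hd)), ← hθ,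
      Category.id_comp]
  have h2 : θ = RingHom.id _ :=
    congrArg CommRingCat.Hom.hom (Spec.map_injective (h1.trans (Spec.map_id _).symm))
  have h3 := hθ' 1 (mono k (2 * d - 1) 1 0) (mono_mem (by omega))
  rw [h2, RingHom.id_apply] at h3
  have h4 := mk_one_injective (pow_ne_zero _ (X_ne_zero 0)) _ h3
  rcases g with i | i
  · rw [act_dihedralRep_r_mono] at h4
    have h5 := congrArg (coeff (expo (2 * d - 1) 1 0)) h4
    rw [coeff_C_mul, coeff_mono, if_pos rfl, mul_one, mul_one, mul_zero, add_zero] at h5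
    have h6 := (isPrimitiveRoot_pow hd hε hda).dvd_of_pow_eq_one _ h5.symm
    have h7 : i.val = 0 := Nat.eq_zero_of_dvd_of_lt h6 (ZMod.val_lt i)
    rw [(ZMod.val_eq_zero i).mp h7]
    rfl
  · rw [act_dihedralRep_sr_mono] at h4
    have h5 := congrArg (coeff (expo (2 * d - 1) 1 0)) h4
    rw [coeff_C_mul, coeff_mono, coeff_mono, if_pos rfl, if_neg (by rw [expo_inj]; omega)] at h5
    simp at h5

/-- Dehomogenization: `t` is `x^{-M}`, so `x^{M-1} y t` and `x^{M-1} z t` are `y/x` and `z/x`. -/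
theorem pow_mul_pow_eq_of_mul_eq_one {A : Type*} [CommRing A] {x y z t : A} {M n i j l : ℕ}
    (hM : 0 < M) (h : x ^ M * t = 1) (hn : i + j + l = n * M) :
    x ^ i * y ^ j * z ^ l * t ^ n = (x ^ (M - 1) * y * t) ^ j * (x ^ (M - 1) * z * t) ^ l := by
  have hx : IsUnit x := by
    refine IsUnit.of_mul_eq_one (x ^ (M - 1) * t) ?_
    rw [← mul_assoc, ← pow_succ', Nat.sub_add_cancel hM, h]
  have hM' : x ^ (M - 1) * x = x ^ M := by rw [← pow_succ, Nat.sub_add_cancel hM]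
  refine (hx.pow (j + l)).mul_right_cancel ?_
  calc x ^ i * y ^ j * z ^ l * t ^ n * x ^ (j + l)
      = x ^ (i + j + l) * t ^ n * (y ^ j * z ^ l) := by ring
    _ = (x ^ M * t) ^ n * (y ^ j * z ^ l) := by rw [hn, mul_comm n, pow_mul, mul_pow]
    _ = ((x ^ M * t) * y) ^ j * ((x ^ M * t) * z) ^ l := by
      rw [h, one_pow, one_mul, one_mul, one_mul]
    _ = _ := by rw [← hM', pow_add]; ring

variable {s : MvPolynomial (Fin 3) k}

theorem mk_mono_eq_mul (hd : 1 ≤ d) (hs : s ∈ homogeneousSubmodule (Fin 3) k (2 * d))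
    (hs0 : s = X 0 ^ (2 * d)) {n i j l : ℕ} (h : i + j + l = n * (2 * d)) :
    Away.mk _ hs n (mono k i j l) (mono_mem h) =
      Away.mk _ hs 1 (mono k (2 * d - 1) 1 0) (mono_mem (by omega)) ^ j *
        Away.mk _ hs 1 (mono k (2 * d - 1) 0 1) (mono_mem (by omega)) ^ l := by
  refine val_injective _ ?_
  rw [val_mul, val_pow, val_pow, val_mk_eq_mul, val_mk_eq_mul, val_mk_eq_mul]
  have ht := IsLocalization.Away.mul_invSelf (S := Localization.Away s) s
  have hs0' := congrArg (algebraMap _ (Localization.Away s)) hs0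
  rw [hs0'] at ht
  simp only [mono, map_mul, map_pow, pow_zero, pow_one, mul_one] at ht ⊢
  have := pow_mul_pow_eq_of_mul_eq_one (by omega) ht h
    (y := algebraMap (MvPolynomial (Fin 3) k) (Localization.Away s) (X 1))
    (z := algebraMap (MvPolynomial (Fin 3) k) (Localization.Away s) (X 2))
  exact this

/-- The chart ring is generated over the constants by `x₁/x₀` and `x₂/x₀`. Agreement on constants is
a hypothesis because the homomorphisms are not assumed `k`-linear. -/
theorem away_ringHom_ext (hd : 1 ≤ d) (hs : s ∈ homogeneousSubmodule (Fin 3) k (2 * d))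
    (hs0 : s = X 0 ^ (2 * d)) {B : Type*} [CommRing B]
    {σ θ : Away (homogeneousSubmodule (Fin 3) k) s →+* B}
    (hconst : ∀ c : homogeneousSubmodule (Fin 3) k 0, σ (algebraMap _ _ c) = θ (algebraMap _ _ c))
    (h1 : σ (Away.mk _ hs 1 (mono k (2 * d - 1) 1 0) (mono_mem (by omega))) =
      θ (Away.mk _ hs 1 (mono k (2 * d - 1) 1 0) (mono_mem (by omega))))
    (h2 : σ (Away.mk _ hs 1 (mono k (2 * d - 1) 0 1) (mono_mem (by omega))) =
      θ (Away.mk _ hs 1 (mono k (2 * d - 1) 0 1) (mono_mem (by omega)))) : σ = θ := by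
  ext z
  have hgen := Away.adjoin_mk_prod_pow_eq_top (𝒜 := homogeneousSubmodule (Fin 3) k)
    hs (Fin 3) X adjoin_zero_X (fun _ => 1) (isHomogeneous_X k)
  have hz : z ∈ Algebra.adjoin _ _ := hgen.ge (Algebra.mem_top : z ∈ ⊤)
  induction hz using Algebra.adjoin_induction with
  | mem b hb =>
    obtain ⟨n, ai, hai, -, rfl⟩ := hb
    have hai' : ai 0 + ai 1 + ai 2 = n * (2 * d) := by
      simpa [Fin.sum_univ_three] using hai
    have hb : Away.mk _ hs n (∏ j, X j ^ ai j) (hai ▸ SetLike.prod_pow_mem_graded _ _ _ _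
        fun j _ => isHomogeneous_X k j) = Away.mk _ hs n (mono k (ai 0) (ai 1) (ai 2))
          (mono_mem hai') := by
      refine val_injective _ ?_
      rw [val_mk_eq_mul, val_mk_eq_mul, Fin.prod_univ_three, mono]
    refine (congrArg σ hb).trans (Eq.trans ?_ (congrArg θ hb).symm)
    rw [mk_mono_eq_mul hd hs hs0 hai', map_mul, map_mul, map_pow, map_pow, map_pow, map_pow, h1,
      h2]
  | algebraMap c => exact hconst c
  | add b c _ _ hb hc => rw [map_add, map_add, hb, hc]
  | mul b c _ _ hb hc => rw [map_mul, map_mul, hb, hc]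

/-- The inclusion of the constants in `k[x]_{(s)}`. -/
def constHom (s : MvPolynomial (Fin 3) k) : k →+* Away (homogeneousSubmodule (Fin 3) k) s :=
  (fromZeroRingHom (homogeneousSubmodule (Fin 3) k) _).comp
    { toFun c := ⟨C c, isHomogeneous_C _ _⟩
      map_one' := Subtype.ext C_1
      map_mul' _ _ := Subtype.ext C_mul
      map_zero' := Subtype.ext C_0
      map_add' _ _ := Subtype.ext C_add }

theorem val_constHom (c : k) : (constHom s c).val =
    algebraMap (MvPolynomial (Fin 3) k) (Localization.Away s) (C c) :=
  Localization.mk_one_eq_algebraMap _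

theorem mk_C_mul (hs : s ∈ homogeneousSubmodule (Fin 3) k N) {n : ℕ} (c : k)
    {p : MvPolynomial (Fin 3) k} (hp : p ∈ homogeneousSubmodule (Fin 3) k (n • N))
    (hp' : C c * p ∈ homogeneousSubmodule (Fin 3) k (n • N)) :
    Away.mk _ hs n (C c * p) hp' = constHom s c * Away.mk _ hs n p hp := by
  refine val_injective _ ?_
  rw [val_mul, val_constHom, val_mk_eq_mul, val_mk_eq_mul, map_mul, mul_assoc]

end DeckTransformations

end

end GTSystem

namespace GTSystem

noncomputable section

/-! ### The deck group is the dihedral group. -/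

section DeckGroup

open HomogeneousLocalization

attribute [local instance] MvPolynomial.gradedAlgebra

variable {k : Type u} [Field k] {d a r : ℕ} {ε : kˣ}
  {F : Fin r → MvPolynomial (Fin 3) k}

theorem act_dihedralRep_basisForms [NeZero d] (hd : 2 ≤ d) (hε : IsPrimitiveRoot ε (2 * d)) (ha : a ≤ d)
    (hda : Nat.gcd d a = 1) (g : DihedralGroup d) {f : MvPolynomial (Fin 3) k}
    (hf : f ∈ basisForms d ε) : act (dihedralRep d a ε hε ha g) f = f :=
  (range_dihedralRep_le_fixer hd hε ha).mpr (basisForms_invariant (by omega) hε ha hda hf) ⟨g, rfl⟩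

theorem mk_eq_constHom_mul {N : ℕ} {s : MvPolynomial (Fin 3) k}
    (hs : s ∈ homogeneousSubmodule (Fin 3) k N) {n : ℕ} {p q : MvPolynomial (Fin 3) k} {c : k}
    (h : p = C c * q) (hp : p ∈ homogeneousSubmodule (Fin 3) k (n • N))
    (hq : q ∈ homogeneousSubmodule (Fin 3) k (n • N)) :
    Away.mk _ hs n p hp = constHom s c * Away.mk _ hs n q hq := by
  subst h
  exact mk_C_mul hs c hq hp

/-- The fraction `x_1 / x_0` in the chart `x_0 ≠ 0`. -/
def fracOne (hd : 1 ≤ d) {s : MvPolynomial (Fin 3) k}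
    (hs : s ∈ homogeneousSubmodule (Fin 3) k (2 * d)) : Away (homogeneousSubmodule (Fin 3) k) s :=
  Away.mk _ hs 1 (mono k (2 * d - 1) 1 0) (mono_mem (by omega))

/-- The fraction `x_2 / x_0` in the chart `x_0 ≠ 0`. -/
def fracTwo (hd : 1 ≤ d) {s : MvPolynomial (Fin 3) k}
    (hs : s ∈ homogeneousSubmodule (Fin 3) k (2 * d)) : Away (homogeneousSubmodule (Fin 3) k) s :=
  Away.mk _ hs 1 (mono k (2 * d - 1) 0 1) (mono_mem (by omega))

section

variable {s : MvPolynomial (Fin 3) k} (hs : s ∈ homogeneousSubmodule (Fin 3) k (2 * d))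

theorem mk_mono_ne_zero (hs0 : s ≠ 0) {i j l : ℕ} (h : i + j + l = 1 * (2 * d)) :
    Away.mk _ hs 1 (mono k i j l) (mono_mem h) ≠ 0 := fun h0 => by
  have : mono k i j l = 0 := by
    refine mk_one_injective hs0 hs (hp := mono_mem h) (hq := zero_mem _) (h0.trans ?_)
    refine val_injective _ ?_
    rw [val_mk_eq_mul, map_zero, zero_mul, val_zero]
  rw [mono_eq_monomial] at this
  exact one_ne_zero (monomial_eq_zero.mp this)

theorem fracOne_mul_fracTwo (hd : 1 ≤ d) (hs0 : s = X 0 ^ (2 * d))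
    (hm : mono k (2 * d - 2 * 1) 1 1 ∈ homogeneousSubmodule (Fin 3) k (1 • (2 * d))) :
    Away.mk _ hs 1 (mono k (2 * d - 2 * 1) 1 1) hm = fracOne hd hs * fracTwo hd hs := by
  have := mk_mono_eq_mul (k := k) hd hs hs0 (n := 1) (i := 2 * d - 2 * 1) (j := 1) (l := 1)
    (by omega)
  rw [pow_one, pow_one] at this
  exact this

theorem fracOne_pow_add_fracTwo_pow (hd : 1 ≤ d) (hs0 : s = X 0 ^ (2 * d))
    (hm : mono k d d 0 + mono k d 0 d ∈ homogeneousSubmodule (Fin 3) k (1 • (2 * d))) :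
    Away.mk _ hs 1 (mono k d d 0 + mono k d 0 d) hm = fracOne hd hs ^ d + fracTwo hd hs ^ d := by
  have h1 := mk_mono_eq_mul (k := k) hd hs hs0 (n := 1) (i := d) (j := d) (l := 0) (by omega)
  have h2 := mk_mono_eq_mul (k := k) hd hs hs0 (n := 1) (i := d) (j := 0) (l := d) (by omega)
  rw [pow_zero, mul_one] at h1
  refine Eq.trans ?_ (congrArg₂ (· + ·) h1 (h2.trans (by rw [pow_zero, one_mul]; rfl)))
  refine val_injective _ ?_
  rw [val_add, val_mk_eq_mul, val_mk_eq_mul, val_mk_eq_mul, map_add, add_mul]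

theorem mk_act_r_fracOne [NeZero d] (hd : 1 ≤ d) (hε : IsPrimitiveRoot ε (2 * d)) (ha : a ≤ d) {n : ℕ}
    (hn : n < d)
    (hm : act (dihedralRep d a ε hε ha (.r n)) (mono k (2 * d - 1) 1 0) ∈
      homogeneousSubmodule (Fin 3) k (1 • (2 * d))) :
    Away.mk _ hs 1 (act (dihedralRep d a ε hε ha (.r n)) (mono k (2 * d - 1) 1 0)) hm =
      constHom s (((ε ^ 2 : kˣ) : k) ^ a) ^ n * fracOne hd hs := by
  have h : act (dihedralRep d a ε hε ha (.r n)) (mono k (2 * d - 1) 1 0) =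
      C ((((ε ^ 2 : kˣ) : k) ^ a) ^ n) * mono k (2 * d - 1) 1 0 := by
    rw [act_dihedralRep_r_mono, ZMod.val_natCast_of_lt hn, mul_one, mul_zero, add_zero]
  rw [mk_eq_constHom_mul hs h hm (mono_mem (by omega)), map_pow _ _ n]
  rfl

theorem mk_act_r_fracTwo [NeZero d] (hd : 1 ≤ d) (hε : IsPrimitiveRoot ε (2 * d)) (ha : a ≤ d) {n : ℕ}
    (hn : n < d)
    (hm : act (dihedralRep d a ε hε ha (.r n)) (mono k (2 * d - 1) 0 1) ∈
      homogeneousSubmodule (Fin 3) k (1 • (2 * d))) :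
    Away.mk _ hs 1 (act (dihedralRep d a ε hε ha (.r n)) (mono k (2 * d - 1) 0 1)) hm =
      constHom s (((ε ^ 2 : kˣ) : k) ^ (d - a)) ^ n * fracTwo hd hs := by
  have h : act (dihedralRep d a ε hε ha (.r n)) (mono k (2 * d - 1) 0 1) =
      C ((((ε ^ 2 : kˣ) : k) ^ (d - a)) ^ n) * mono k (2 * d - 1) 0 1 := by
    rw [act_dihedralRep_r_mono, ZMod.val_natCast_of_lt hn, mul_one, mul_zero, zero_add]
  rw [mk_eq_constHom_mul hs h hm (mono_mem (by omega)), map_pow _ _ n]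
  rfl

theorem mk_act_sr_fracOne [NeZero d] (hd : 1 ≤ d) (hε : IsPrimitiveRoot ε (2 * d)) (ha : a ≤ d) {n : ℕ}
    (hn : n < d)
    (hm : act (dihedralRep d a ε hε ha (.sr n)) (mono k (2 * d - 1) 1 0) ∈
      homogeneousSubmodule (Fin 3) k (1 • (2 * d))) :
    Away.mk _ hs 1 (act (dihedralRep d a ε hε ha (.sr n)) (mono k (2 * d - 1) 1 0)) hm =
      constHom s (((ε ^ 2 : kˣ) : k) ^ a) ^ n * fracTwo hd hs := by
  have h : act (dihedralRep d a ε hε ha (.sr n)) (mono k (2 * d - 1) 1 0) =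
      C ((((ε ^ 2 : kˣ) : k) ^ a) ^ n) * mono k (2 * d - 1) 0 1 := by
    rw [act_dihedralRep_sr_mono, ZMod.val_natCast_of_lt hn, mul_one, mul_zero, add_zero]
  rw [mk_eq_constHom_mul hs h hm (mono_mem (by omega)), map_pow _ _ n]
  rfl

theorem mk_act_sr_fracTwo [NeZero d] (hd : 1 ≤ d) (hε : IsPrimitiveRoot ε (2 * d)) (ha : a ≤ d) {n : ℕ}
    (hn : n < d)
    (hm : act (dihedralRep d a ε hε ha (.sr n)) (mono k (2 * d - 1) 0 1) ∈
      homogeneousSubmodule (Fin 3) k (1 • (2 * d))) :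
    Away.mk _ hs 1 (act (dihedralRep d a ε hε ha (.sr n)) (mono k (2 * d - 1) 0 1)) hm =
      constHom s (((ε ^ 2 : kˣ) : k) ^ (d - a)) ^ n * fracOne hd hs := by
  have h : act (dihedralRep d a ε hε ha (.sr n)) (mono k (2 * d - 1) 0 1) =
      C ((((ε ^ 2 : kˣ) : k) ^ (d - a)) ^ n) * mono k (2 * d - 1) 1 0 := by
    rw [act_dihedralRep_sr_mono, ZMod.val_natCast_of_lt hn, mul_one, mul_zero, zero_add]
  rw [mk_eq_constHom_mul hs h hm (mono_mem (by omega)), map_pow _ _ n]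
  rfl

end

theorem pow_sub_mul_pow (hε : IsPrimitiveRoot ε (2 * d)) (ha : a ≤ d) :
    (((ε ^ 2 : kˣ) : k) ^ (d - a)) * (((ε ^ 2 : kˣ) : k) ^ a) = 1 := by
  rw [← pow_add, Nat.sub_add_cancel ha, ← Units.val_pow_eq_pow_val, ← pow_mul, hε.pow_eq_one,
    Units.val_one]

/-- An endomorphism of the chart `x_0 ≠ 0` fixing the basis forms comes from the dihedral group. -/
theorem exists_dihedral_of_fixes [NeZero d] (hd : 1 ≤ d) (hε : IsPrimitiveRoot ε (2 * d)) (ha : a ≤ d)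
    (hda : Nat.gcd d a = 1) {s : MvPolynomial (Fin 3) k}
    (hs : s ∈ homogeneousSubmodule (Fin 3) k (2 * d)) (hs0 : s = X 0 ^ (2 * d))
    {σ : Away (homogeneousSubmodule (Fin 3) k) s →+* Away (homogeneousSubmodule (Fin 3) k) s}
    (hσ : ∀ f ∈ basisForms d ε, ∀ hf : f ∈ homogeneousSubmodule (Fin 3) k (1 • (2 * d)),
      σ (Away.mk _ hs 1 f hf) = Away.mk _ hs 1 f hf) :
    ∃ g : DihedralGroup d,
      (∀ hf, σ (fracOne hd hs) = Away.mk _ hs 1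
        (act (dihedralRep d a ε hε ha g) (mono k (2 * d - 1) 1 0)) hf) ∧
      ∀ hf, σ (fracTwo hd hs) = Away.mk _ hs 1
        (act (dihedralRep d a ε hε ha g) (mono k (2 * d - 1) 0 1)) hf := by
  have hs1 : s ≠ 0 := by rw [hs0]; exact pow_ne_zero _ (X_ne_zero 0)
  have hdom := isDomain_away hs1
  -- The basis forms `x₀^{2d-2} x₁x₂` and `x₀^d (x₁^d + x₂^d)`, divided by `x₀^{2d}`, are `uv` and
  -- `u^d + v^d` with `u = x₁/x₀`, `v = x₂/x₀`.
  have hmul : σ (fracOne hd hs) * σ (fracTwo hd hs) = fracOne hd hs * fracTwo hd hs := by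
    rw [← map_mul, ← fracOne_mul_fracTwo hs hd hs0 (mono_mem (by omega))]
    exact hσ _ ((mem_basisForms hd hε).mpr (Or.inl ⟨1, hd, rfl⟩)) _
  have hadd : σ (fracOne hd hs) ^ d + σ (fracTwo hd hs) ^ d =
      fracOne hd hs ^ d + fracTwo hd hs ^ d := by
    rw [← map_pow, ← map_pow, ← map_add, ← fracOne_pow_add_fracTwo_pow hs hd hs0
      (add_mem (mono_mem (by omega)) (mono_mem (by omega)))]
    exact hσ _ ((mem_basisForms hd hε).mpr
      (Or.inr ⟨d, d, 0, by omega, by omega, by simp, rfl⟩)) _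
  have hζ : IsPrimitiveRoot (constHom s (((ε ^ 2 : kˣ) : k) ^ a)) d :=
    (isPrimitiveRoot_pow hd hε hda).map_of_injective (constHom s).injective
  have hinv : ∀ n : ℕ, constHom s (((ε ^ 2 : kˣ) : k) ^ (d - a)) ^ n *
      constHom s (((ε ^ 2 : kˣ) : k) ^ a) ^ n = 1 := fun n => by
    rw [← mul_pow, ← map_mul, pow_sub_mul_pow hε ha, map_one, one_pow]
  obtain ⟨n, hn, ⟨h1, h2⟩ | ⟨h1, h2⟩⟩ :=
    exists_dihedral_of_mul_eq_of_pow_add_eq hd hζ (mk_mono_ne_zero hs hs1 (by omega))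
      (mk_mono_ne_zero hs hs1 (by omega)) hmul hadd
  · refine ⟨.r n, fun hf => ?_, fun hf => ?_⟩
    · rw [mk_act_r_fracOne hs hd hε ha hn hf]
      exact h1
    · rw [mk_act_r_fracTwo hs hd hε ha hn hf]
      refine Eq.trans ?_ (congrArg _ h2)
      rw [← mul_assoc, hinv, one_mul]
  · refine ⟨.sr n, fun hf => ?_, fun hf => ?_⟩
    · rw [mk_act_sr_fracOne hs hd hε ha hn hf]
      exact h1
    · rw [mk_act_sr_fracTwo hs hd hε ha hn hf]
      refine Eq.trans ?_ (congrArg _ h2)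
      rw [← mul_assoc, hinv, one_mul]

theorem IsMorphismOfForms.exists_eq_projAct [NeZero d] (hd : 2 ≤ d) (hε : IsPrimitiveRoot ε (2 * d))
    (ha : a ≤ d) (hda : Nat.gcd d a = 1) {hN : 0 < 2 * d}
    {hF : ∀ i, (F i).IsHomogeneous (2 * d)} (hB : Set.range F = basisForms d ε)
    {φ : projSpace k 3 ⟶ projSpace k r} (h : IsMorphismOfForms hN F hF φ)
    {ψ : projSpace k 3 ⟶ projSpace k 3} (hψ : ψ ≫ φ = φ) :
    ∃ g : DihedralGroup d, ψ = projAct (dihedralRep d a ε hε ha g) := by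
  obtain ⟨i, hi⟩ := hB.ge (X_zero_pow_mem_basisForms (by omega) hε)
  have hs0 : aeval F (X i : MvPolynomial (Fin r) k) = X 0 ^ (2 * d) := (aeval_X F i).trans hi
  obtain ⟨σ, hσ⟩ := h.exists_chart hψ i
  have hσF := h.comp_awayHom hψ i hσ
  obtain ⟨g, hg1, hg2⟩ := exists_dihedral_of_fixes (by omega) hε ha hda (aeval_X_mem hF i) hs0 (σ := σ) (by
    intro f hf hf'
    rw [← hB] at hf
    obtain ⟨l, rfl⟩ := hf
    obtain ⟨z, hz⟩ := mk_mem_range_awayHom hF i l hf'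
    rw [← hz]
    exact DFunLike.congr_fun hσF z)
  have hinv : ∀ l, act (dihedralRep d a ε hε ha g) (F l) = F l := fun l =>
    act_dihedralRep_basisForms hd hε ha hda g (hB.le ⟨l, rfl⟩)
  obtain ⟨θ, hθ, hθ'⟩ := exists_awayι_comp_projAct (dihedralRep d a ε hε ha g) hN
    (aeval_X_mem hF i) (aeval_X_mem hF i) (by rw [aeval_X]; exact hinv i)
  have hθF := h.comp_awayHom (h.projAct_comp _ hinv) i hθ
  have hσθ : σ = θ := by
    refine away_ringHom_ext (by omega) (aeval_X_mem hF i) hs0 (fun c => ?_) ?_ ?_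
    -- Constants are pulled back from the target of `φ`, so any endomorphism over `φ` fixes them and
    -- is automatically `k`-linear.
    · obtain ⟨z, hz⟩ := algebraMap_zero_mem_range hF (X i) c
      rw [← hz]
      exact (DFunLike.congr_fun hσF z).trans (DFunLike.congr_fun hθF z).symm
    · rw [hθ']
      exact hg1 _
    · rw [hθ']
      exact hg2 _
  -- The chart is dense, so equality on it extends to the whole plane.
  have := isDominant_awayι (hs0 ▸ pow_ne_zero _ (X_ne_zero 0)) hN (aeval_X_mem hF i)
  refine ⟨g, ext_of_isDominant (ι := Proj.awayι (homogeneousSubmodule (Fin 3) k) _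
    (aeval_X_mem hF i) hN) ?_⟩
  rw [hσ, hθ, hσθ]

/-- The projective transformation given by a linear substitution, as an isomorphism. -/
def projActIso (g : GL (Fin 3) k) : projSpace k 3 ≅ projSpace k 3 where
  hom := projAct g
  inv := projAct g⁻¹
  hom_inv_id := by rw [← projAct_mul, mul_inv_cancel, projAct_one]
  inv_hom_id := by rw [← projAct_mul, inv_mul_cancel, projAct_one]

/-- The deck transformations given by a group of linear substitutions. -/
def deckHom {G : Type*} [Group G] (ρ : G →* GL (Fin 3) k) {Z : Scheme.{u}}
    (f : projSpace k 3 ⟶ Z) (hf : ∀ g, projAct (ρ g) ≫ f = f) : G →* DeckGroup f where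
  -- `projAct` turns products into composites in diagrammatic order, opposite to multiplication in
  -- `Aut`; the inverse restores a homomorphism.
  toFun g := Over.isoMk (projActIso (ρ g⁻¹)) (hf g⁻¹)
  map_one' := by
    refine Iso.ext (Over.OverMorphism.ext ?_)
    change projAct (ρ 1⁻¹) = 𝟙 _
    rw [inv_one, map_one, projAct_one]
  map_mul' g h := by
    refine Iso.ext (Over.OverMorphism.ext ?_)
    change projAct (ρ (g * h)⁻¹) = projAct (ρ h⁻¹) ≫ projAct (ρ g⁻¹)
    rw [mul_inv_rev, map_mul, projAct_mul]

theorem deckHom_hom_left {G : Type*} [Group G] (ρ : G →* GL (Fin 3) k) {Z : Scheme.{u}}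
    (f : projSpace k 3 ⟶ Z) (hf : ∀ g, projAct (ρ g) ≫ f = f) (g : G) :
    (deckHom ρ f hf g).hom.left = projAct (ρ g⁻¹) := rfl

theorem IsMorphismOfForms.nonempty_deckGroup_mulEquiv [NeZero d] (hd : 2 ≤ d)
    (hε : IsPrimitiveRoot ε (2 * d)) (ha : a ≤ d) (hda : Nat.gcd d a = 1) {hN : 0 < 2 * d}
    {hF : ∀ i, (F i).IsHomogeneous (2 * d)} (hB : Set.range F = basisForms d ε)
    {φ : projSpace k 3 ⟶ projSpace k r} (h : IsMorphismOfForms hN F hF φ)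
    (hf : ∀ g, projAct (dihedralRep d a ε hε ha g) ≫ φ.toImage = φ.toImage) :
    Nonempty (DeckGroup φ.toImage ≃* DihedralGroup d) := by
  refine ⟨(MulEquiv.ofBijective (deckHom (dihedralRep d a ε hε ha) φ.toImage hf)
    ⟨?_, fun g => ?_⟩).symm⟩
  · refine (injective_iff_map_eq_one _).mpr fun g hg => ?_
    have h1 : projAct (dihedralRep d a ε hε ha g⁻¹) = 𝟙 _ :=
      congrArg (fun x : DeckGroup φ.toImage => x.hom.left) hg
    exact inv_eq_one.mp (eq_one_of_projAct_eq_id hε ha hda h1)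
  · have hg : g.hom.left ≫ φ = φ := by
      have : g.hom.left ≫ φ.toImage = φ.toImage := Over.w g.hom
      have h' := congrArg (· ≫ φ.imageι) this
      simp only [Category.assoc, φ.toImage_imageι] at h'
      exact h'
    obtain ⟨x, hx⟩ := h.exists_eq_projAct hd hε ha hda hB hg
    refine ⟨x⁻¹, Iso.ext (Over.OverMorphism.ext ?_)⟩
    rw [deckHom_hom_left, inv_inv]
    exact hx.symm

theorem IsMorphismOfForms.projAct_comp_toImage {N : ℕ} {hN : 0 < N}
    {hF : ∀ i, (F i).IsHomogeneous N} {φ : projSpace k 3 ⟶ projSpace k r}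
    (h : IsMorphismOfForms hN F hF φ) (g : GL (Fin 3) k) (hg : ∀ i, act g (F i) = F i) :
    projAct g ≫ φ.toImage = φ.toImage := by
  rw [← cancel_mono φ.imageι, Category.assoc, φ.toImage_imageι, h.projAct_comp g hg]

theorem isFinite_toImage {X Y : Scheme.{u}} (f : X ⟶ Y) [IsFinite f] : IsFinite f.toImage := by
  have : IsFinite (f.toImage ≫ f.imageι) := by rw [f.toImage_imageι]; infer_instance
  exact IsFinite.of_comp f.toImage f.imageι

/-- The map to the scheme-theoretic image is dominant, and its range is closed by finiteness. -/
theorem surjective_toImage {X Y : Scheme.{u}} (f : X ⟶ Y) [IsFinite f] :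
    Function.Surjective f.toImage := by
  have := isFinite_toImage f
  have := surjective_of_isDominant_of_isClosed_range f.toImage f.toImage.isClosedMap.isClosed_range
  exact f.toImage.surjective

end DeckGroup

end

end GTSystem

namespace GTSystem

noncomputable section

/-! ### Fibres are dihedral orbits, and the GT-system. -/

section Transitivity

attribute [local instance] MvPolynomial.gradedAlgebra

variable {k : Type u} [Field k]

theorem homogeneousComponent_aeval {m r N : ℕ} (hN : 0 < N) {F : Fin r → MvPolynomial (Fin m) k}
    (hF : ∀ i, (F i).IsHomogeneous N) (P : MvPolynomial (Fin r) k) (l : ℕ) :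
    homogeneousComponent (N * l) (aeval F P) = aeval F (homogeneousComponent l P) := by
  conv_lhs => rw [← sum_homogeneousComponent P, map_sum, map_sum]
  have h : ∀ i, homogeneousComponent (N * l) (aeval F (homogeneousComponent i P)) =
      if i = l then aeval F (homogeneousComponent i P) else 0 := fun i => by
    rw [homogeneousComponent_of_mem (aeval_isHomogeneous hF (homogeneousComponent_mem i P))]
    simp only [Nat.mul_right_inj hN.ne', eq_comm]
  simp_rw [h]
  rw [Finset.sum_ite_eq']
  split_ifs with hl
  · rfl
  · rw [homogeneousComponent_eq_zero, map_zero]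
    simpa using hl

theorem homogeneousComponent_act (g : GL (Fin 3) k) (p : MvPolynomial (Fin 3) k) (n : ℕ) :
    homogeneousComponent n (act g p) = act g (homogeneousComponent n p) := by
  have := homogeneousComponent_aeval one_pos
    (F := fun j => ∑ i, C ((g : Matrix (Fin 3) (Fin 3) k) i j) * X i)
    (fun j => IsHomogeneous.sum _ _ _ fun i _ => isHomogeneous_C_mul_X _ _) p n
  rwa [one_mul] at this

theorem mem_iff_homogeneousComponent_mem {m : ℕ} (y : projSpace k m)
    (p : MvPolynomial (Fin m) k) : p ∈ y.asHomogeneousIdeal.toIdeal ↔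
      ∀ n, homogeneousComponent n p ∈ y.asHomogeneousIdeal.toIdeal := by
  refine ⟨fun h n => ?_, fun h => ?_⟩
  · have := y.asHomogeneousIdeal.isHomogeneous n h
    rwa [← decomposition.decompose'_apply]
  · rw [← sum_homogeneousComponent p]
    exact sum_mem fun n _ => h n

/-- The action of a group of linear substitutions on the polynomial ring. -/
abbrev linearAction {G : Type*} [Group G] (ρ : G →* GL (Fin 3) k) :
    MulSemiringAction G (MvPolynomial (Fin 3) k) where
  smul g p := act (ρ g) p
  one_smul p := by
    change act (ρ 1) p = p
    rw [map_one, act_one_apply]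
  mul_smul g h p := by
    change act (ρ (g * h)) p = act (ρ g) (act (ρ h) p)
    rw [map_mul, act_mul_apply]
  smul_zero g := map_zero (act (ρ g))
  smul_add g := map_add (act (ρ g))
  smul_one g := map_one (act (ρ g))
  smul_mul g := map_mul (act (ρ g))

/-- Two points of the projective plane containing the same invariants of a finite group are
conjugate. -/
theorem exists_projAct_eq {G : Type*} [Group G] [Finite G] (ρ : G →* GL (Fin 3) k)
    {y y' : projSpace k 3}
    (h : ∀ p, (∀ g, act (ρ g) p = p) →
      (p ∈ y.asHomogeneousIdeal.toIdeal ↔ p ∈ y'.asHomogeneousIdeal.toIdeal)) :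
    ∃ g, projAct (ρ g) y = y' := by
  let := linearAction ρ
  have hinv : Algebra.IsInvariant (FixedPoints.subring (MvPolynomial (Fin 3) k) G)
      (MvPolynomial (Fin 3) k) G := ⟨fun b hb => ⟨⟨b, hb⟩, rfl⟩⟩
  have hcomm : SMulCommClass G (FixedPoints.subring (MvPolynomial (Fin 3) k) G)
      (MvPolynomial (Fin 3) k) := ⟨fun g c p => by
    rw [Algebra.smul_def, Algebra.smul_def, smul_mul']
    congr 1
    exact c.2 g⟩
  have hy : y.asHomogeneousIdeal.toIdeal.IsPrime := y.isPrime
  have hy' : y'.asHomogeneousIdeal.toIdeal.IsPrime := y'.isPrime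
  -- Two primes with the same contraction to the ring of invariants of a finite group are conjugate.
  obtain ⟨g, hg⟩ := Algebra.IsInvariant.exists_smul_of_under_eq
    (FixedPoints.subring (MvPolynomial (Fin 3) k) G) (MvPolynomial (Fin 3) k) G
    y.asHomogeneousIdeal.toIdeal y'.asHomogeneousIdeal.toIdeal
    (Ideal.ext fun c => h c.1 c.2)
  refine ⟨g⁻¹, ?_⟩
  refine ProjectiveSpectrum.ext (HomogeneousIdeal.ext (Ideal.ext fun p => ?_))
  rw [hg, Ideal.mem_pointwise_smul_iff_inv_smul_mem]
  rfl

variable {d a r : ℕ} [NeZero d] {ε : kˣ} {F : Fin r → MvPolynomial (Fin 3) k}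

theorem IsMorphismOfForms.aeval_mem_iff {m N : ℕ} {F : Fin r → MvPolynomial (Fin m) k}
    {hN : 0 < N} {hF : ∀ i, (F i).IsHomogeneous N} {φ : projSpace k m ⟶ projSpace k r}
    (h : IsMorphismOfForms hN F hF φ) {y y' : projSpace k m} (hy : φ y = φ y')
    {P : MvPolynomial (Fin r) k} {l : ℕ} (hP : P.IsHomogeneous l) (hl : 0 < l) :
    aeval F P ∈ y.asHomogeneousIdeal.toIdeal ↔ aeval F P ∈ y'.asHomogeneousIdeal.toIdeal := by
  have key : ∀ z : projSpace k m, φ z ∈ Proj.basicOpen (homogeneousSubmodule (Fin r) k) P ↔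
      aeval F P ∉ z.asHomogeneousIdeal.toIdeal := fun z =>
    SetLike.ext_iff.mp (h.preimage_basicOpen hl hP) z
  rw [← not_iff_not, ← key, ← key, hy]

/-- A prime does not distinguish an invariant form from its `2d`-th power, and that power has degree
divisible by `2d`, so it is a polynomial in `F`. Its vanishing at a point depends only on the image
under `φ`. -/
theorem IsMorphismOfForms.mem_iff_of_invariant [CharZero k] (hd : 2 ≤ d)
    (hε : IsPrimitiveRoot ε (2 * d)) (ha : a ≤ d) (hda : Nat.gcd d a = 1) {hN : 0 < 2 * d}
    {hF : ∀ i, (F i).IsHomogeneous (2 * d)} (hB : Set.range F = basisForms d ε)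
    {φ : projSpace k 3 ⟶ projSpace k r} (h : IsMorphismOfForms hN F hF φ) {y y' : projSpace k 3}
    (hy : φ y = φ y') {p : MvPolynomial (Fin 3) k}
    (hp : ∀ g, act (dihedralRep d a ε hε ha g) p = p) :
    p ∈ y.asHomogeneousIdeal.toIdeal ↔ p ∈ y'.asHomogeneousIdeal.toIdeal := by
  rw [mem_iff_homogeneousComponent_mem y, mem_iff_homogeneousComponent_mem y']
  refine forall_congr' fun n => ?_
  have hpn : ∀ g, act (dihedralRep d a ε hε ha g) (homogeneousComponent n p) =
      homogeneousComponent n p := fun g => by rw [← homogeneousComponent_act, hp]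
  have hyp : y.asHomogeneousIdeal.toIdeal.IsPrime := y.isPrime
  have hyp' : y'.asHomogeneousIdeal.toIdeal.IsPrime := y'.isPrime
  rw [← hyp.pow_mem_iff_mem _ hN, ← hyp'.pow_mem_iff_mem _ hN]
  -- Degree zero is separate because the basic-open criterion needs positive degree; a constant lies
  -- in a prime only if it is zero.
  rcases Nat.eq_zero_or_pos n with rfl | hn
  · have hC : ∀ z : projSpace k 3, C (coeff 0 p) ^ (2 * d) ∈ z.asHomogeneousIdeal.toIdeal ↔
        coeff 0 p = 0 := fun z => by
      have hz : z.asHomogeneousIdeal.toIdeal.IsPrime := z.isPrime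
      rw [hz.pow_mem_iff_mem _ hN]
      refine ⟨fun hc => ?_, fun hc => by rw [hc, C_0]; exact zero_mem _⟩
      by_contra h0
      exact hz.ne_top (Ideal.eq_top_of_isUnit_mem _ hc ((isUnit_iff_ne_zero.mpr h0).map C))
    rw [homogeneousComponent_zero, hC, hC]
  · have hhom : (homogeneousComponent n p ^ (2 * d)).IsHomogeneous (2 * d * n) := by
      rw [mul_comm (2 * d)]
      exact (homogeneousComponent_isHomogeneous n p).pow _
    have hmem := mem_adjoin_of_invariant (by omega) hε ha hda hhom
      (by rw [map_pow, ← dihedralRep_r_one hd hε ha, hpn])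
      (by rw [map_pow, ← dihedralRep_sr_zero hε ha, hpn])
    rw [← hB, Algebra.adjoin_range_eq_range_aeval] at hmem
    obtain ⟨P, hP⟩ := hmem
    -- The polynomial `P` need not be homogeneous, but its component of degree `n` already gives the
    -- form of degree `2dn`.
    have hP' : aeval F (homogeneousComponent n P) = homogeneousComponent n p ^ (2 * d) := by
      rw [← homogeneousComponent_aeval hN hF, homogeneousComponent_of_mem (n := 2 * d * n)
        (by rw [mem_homogeneousSubmodule]; exact hP ▸ hhom), if_pos rfl]
      exact hP
    rw [← hP']
    exact h.aeval_mem_iff hy (homogeneousComponent_isHomogeneous n P) hn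

theorem IsMorphismOfForms.isGaloisCovering [CharZero k] (hd : 2 ≤ d)
    (hε : IsPrimitiveRoot ε (2 * d)) (ha : a ≤ d) (hda : Nat.gcd d a = 1) {hN : 0 < 2 * d}
    {hF : ∀ i, (F i).IsHomogeneous (2 * d)} (hB : Set.range F = basisForms d ε)
    {φ : projSpace k 3 ⟶ projSpace k r} (h : IsMorphismOfForms hN F hF φ) :
    IsGaloisCovering φ.toImage (DihedralGroup d) := by
  have hfin : IsFinite φ := h.isFinite (isIntegralElem_X_pow (by omega) hε hF hB)
  have hρ : ∀ g, projAct (dihedralRep d a ε hε ha g) ≫ φ.toImage = φ.toImage := fun g =>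
    h.projAct_comp_toImage _ fun i => act_dihedralRep_basisForms hd hε ha hda g (hB.le ⟨i, rfl⟩)
  refine ⟨isFinite_toImage φ, surjective_toImage φ, fun y y' hy => ?_,
    h.nonempty_deckGroup_mulEquiv hd hε ha hda hB hρ⟩
  have hy' : φ y = φ y' := by
    rw [← φ.toImage_imageι, Scheme.Hom.comp_apply, Scheme.Hom.comp_apply, hy]
  obtain ⟨g, hg⟩ := exists_projAct_eq (dihedralRep d a ε hε ha) fun p hp =>
    h.mem_iff_of_invariant hd hε ha hda hB hy' hp
  refine ⟨deckHom (dihedralRep d a ε hε ha) φ.toImage hρ g⁻¹, ?_⟩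
  rw [deckHom_hom_left, inv_inv, hg]

theorem isGTSystem_basisForms [CharZero k] (hd : 3 ≤ d) (hε : IsPrimitiveRoot ε (2 * d))
    (ha : a ≤ d) (hda : Nat.gcd d a = 1) (hB : Set.range F = basisForms d ε)
    (hr : r ≤ 2 * d + 1) (hN : 0 < 2 * d) :
    IsGTSystem (n := 2) hN F (DihedralGroup d) := by
  have hF : ∀ i, (F i).IsHomogeneous (2 * d) := fun i =>
    basisForms_isHomogeneous (by omega) hε (hB.le ⟨i, rfl⟩)
  refine ⟨⟨hF, ?_, ?_, ?_⟩, ?_⟩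
  · rw [show 2 - 1 = 1 from rfl, Nat.choose_one_right]
    omega
  · rw [hB]
    exact isArtinianRing_basisForms (by omega) hε
  · rw [hB]
    exact failsWLP_basisForms hd hε
  · obtain ⟨φ, hφ⟩ := exists_isMorphismOfForms hN hF (iSup_basicOpen_eq_top (by omega) hε hB)
    exact ⟨φ, hφ, hφ.isGaloisCovering (by omega) hε ha hda hB⟩

end Transitivity

end

end GTSystem

/-! ### The theorem, assembled. -/

theorem proposition4p3 {k : Type u} [Field k] [IsAlgClosed k] [CharZero k]
    (d a : ℕ) [NeZero d] (hd : 3 ≤ d) (ha₀ : 0 < a) (ha : 2 * a < d) (hda : Nat.gcd d a = 1)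
    (ε : kˣ) (hε : IsPrimitiveRoot ε (2 * d))
    (ρ : DihedralGroup d →* GL (Fin 3) k) (hρ : ρ = dihedralRep d a ε hε (by omega))
    (μ : ℕ)
    (hμ : μ = Module.finrank k (invariantForms (extendedDihedral d a ε hε (by omega)) (2 * d)))
    (I : Ideal (MvPolynomial (Fin 3) k)) (hI : I = Ideal.span (basisForms d ε)) :
    -- `I` is generated by the `μ ≤ 2d + 1` elements of `basisForms`,
    -- and is the ideal generated by all invariant forms of degree `2d`
    Nonempty (Fin μ ≃ basisForms d ε) ∧ μ ≤ 2 * d + 1 ∧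
    I = Ideal.span (invariantForms (extendedDihedral d a ε hε (by omega)) (2 * d) :
      Set (MvPolynomial (Fin 3) k)) ∧
    -- `I` is artinian and not monomial
    IsArtinianRing (MvPolynomial (Fin 3) k ⧸ I) ∧
    ¬ IsMonomialIdeal I ∧
    -- `I` fails the weak Lefschetz property from degree `2d - 1` to degree `2d`, because for each
    -- linear form `L ≠ 0` multiplication by `L` kills the nonzero class of `∏_{g ≠ 1} g(L)`
    FailsWLPInDegree I (2 * d - 1) ∧
    (∀ L ∈ homogeneousSubmodule (Fin 3) k 1,
      L * ∏ g ∈ Finset.univ.erase (1 : DihedralGroup d), act (ρ g) L ∈ I ∧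
      (L ≠ 0 → ∏ g ∈ Finset.univ.erase (1 : DihedralGroup d), act (ρ g) L ∉ I)) ∧
    -- `I` is a GT-system with the dihedral group of order `2d`
    (∀ F : Fin μ ≃ basisForms d ε,
      IsGTSystem (n := 2) (N := 2 * d) (by omega)
        (fun i => (F i : MvPolynomial (Fin 3) k)) (DihedralGroup d)) := by
  subst hρ hμ hI
  have had : a ≤ d := by omega
  have hcard := finrank_invariantForms (k := k) (by omega) hε had hda
  have hle : Module.finrank k (invariantForms (extendedDihedral d a ε hε had) (2 * d)) ≤
      2 * d + 1 := hcard.le.trans (ncard_basisForms_le hd hε)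
  have hfin := (finite_basisForms (k := k) (d := d) (by omega) hε).to_subtype
  refine ⟨?_, hle, ?_, isArtinianRing_basisForms (by omega) hε,
    not_isMonomialIdeal (by omega) hε, failsWLP_basisForms hd hε, fun L hL =>
      ⟨prod_act_mem (by omega) hε had hda hL, fun hL0 =>
        prod_erase_act_notMem (by omega) hε had hL hL0⟩, fun F => ?_⟩
  · rw [hcard]
    exact ⟨(Finite.equivFin _).symm⟩
  · rw [invariantForms_eq_span (by omega) hε had hda]
    exact (Submodule.span_span_of_tower k _ _).symm
  · refine isGTSystem_basisForms hd hε had hda ?_ hle _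
    exact (F.surjective.range_comp Subtype.val).trans Subtype.range_coe
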